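/- Let $F$ be a finite field with $q$ elements, let $V$ be a vector space over $F$ of finite dimension $d$, let $m$ be a non-negative integer, and let $\Omega$ be the set of all $m$-dimensional subspaces of $V$, with $n = |\Omega|$. Let $G$ be a subgroup of $\mathrm{Sym}(\Omega)$ which is almost simple (that is, for some nonabelian simple group $S$, $G$ is isomorphic to a group lying between $\mathrm{Inn}(S)$ and $\mathrm{Aut}(S)$) and whose socle (the subgroup generated by its minimal normal subgroups) is the image in $\mathrm{Sym}(\Omega)$ of $\mathrm{PSL}_d(q) = \mathrm{SL}(V)/Z(\mathrm{SL}(V))$ in its natural action on $m$-subspaces. (These hypotheses force $0 < m < d$, so that $\mathrm{PSL}_d(q)$ acts faithfully.) An irredundant base for $G$ is a sequence $(\omega_1, \dots, \omega_l)$ of points of $\Omega$ such that $G > G_{\omega_1} > G_{\omega_1,\omega_2} > \dots > G_{\omega_1,\dots,\omega_l} = 1$, where $G_{\omega_1,\dots,\omega_i}$ is the pointwise stabilizer and all inclusions are strict; let $\mathrm{I}(G)$ be the maximal length of an irredundant base for $G$. Then $$\mathrm{I}(G) < 3 \log_2 n.$$ -/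

import Mathlib

/-! ### Irredundant bases of permutation groups -/

section Bases

variable {Ω : Type*}

/-- The pointwise stabiliser `G_{ω₁, …, ω_l}` in a permutation group `G` of a sequence of points. -/
def seqStabilizer (G : Subgroup (Equiv.Perm Ω)) (L : List Ω) : Subgroup (Equiv.Perm Ω) where
  carrier := {g | g ∈ G ∧ ∀ ω ∈ L, g ω = ω}
  one_mem' := ⟨G.one_mem, fun _ _ => rfl⟩
  mul_mem' := by
    rintro a b ⟨ha, ha'⟩ ⟨hb, hb'⟩
    exact ⟨G.mul_mem ha hb, fun ω hω => by rw [Equiv.Perm.mul_apply, hb' ω hω, ha' ω hω]⟩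
  inv_mem' := by
    rintro a ⟨ha, ha'⟩
    exact ⟨G.inv_mem ha, fun ω hω => by rw [Equiv.Perm.inv_eq_iff_eq, ha' ω hω]⟩

/-- Each point of the sequence properly shrinks the stabiliser of the preceding points:
`G > G_{ω₁} > G_{ω₁, ω₂} > ⋯ > G_{ω₁, …, ω_l}`. -/
def IsIrredundantSeq (G : Subgroup (Equiv.Perm Ω)) (L : List Ω) : Prop :=
  ∀ i < L.length, seqStabilizer G (L.take (i + 1)) < seqStabilizer G (L.take i)

/-- An irredundant base for `G`: a sequence with
`G > G_{ω₁} > G_{ω₁, ω₂} > ⋯ > G_{ω₁, …, ω_l} = 1`. -/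
def IsIrredundantBase (G : Subgroup (Equiv.Perm Ω)) (L : List Ω) : Prop :=
  IsIrredundantSeq G L ∧ seqStabilizer G L = ⊥

/-- `I(G)`: the maximal length of an irredundant base for `G`. For finite `Ω` the maximum exists,
see `isGreatest_maxIrredundantBaseSize`. -/
noncomputable def maxIrredundantBaseSize (G : Subgroup (Equiv.Perm Ω)) : ℕ :=
  sSup {l : ℕ | ∃ L : List Ω, IsIrredundantBase G L ∧ L.length = l}

theorem IsIrredundantSeq.nodup {G : Subgroup (Equiv.Perm Ω)} {L : List Ω}
    (h : IsIrredundantSeq G L) : L.Nodup := by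
  rw [List.Nodup, List.pairwise_iff_getElem]
  intro i j hi hj hij heq
  refine (h j hj).not_ge ?_
  rintro g ⟨hg, hg'⟩
  refine ⟨hg, fun ω hω => ?_⟩
  rw [List.take_add_one, List.mem_append] at hω
  rcases hω with hω | hω
  · exact hg' ω hω
  · rw [List.getElem?_eq_getElem hj] at hω
    have hω' : ω = L[j] := by simpa using hω
    rw [hω', ← heq]
    exact hg' _ (List.mem_take_iff_getElem.2 ⟨i, by omega, rfl⟩)

/-- For finite `Ω`, irredundant bases exist and `I(G)` is the largest of their lengths. -/
theorem isGreatest_maxIrredundantBaseSize [Finite Ω] (G : Subgroup (Equiv.Perm Ω)) :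
    IsGreatest {l : ℕ | ∃ L : List Ω, IsIrredundantBase G L ∧ L.length = l}
      (maxIrredundantBaseSize G) := by
  have := Fintype.ofFinite Ω
  have hbd : ∀ L : List Ω, IsIrredundantSeq G L → L.length ≤ Fintype.card Ω :=
    fun L hL => hL.nodup.length_le_card
  let S : Set ℕ := {l : ℕ | ∃ L : List Ω, IsIrredundantSeq G L ∧ L.length = l}
  have hS : BddAbove S := ⟨Fintype.card Ω, by rintro _ ⟨L, hL, rfl⟩; exact hbd L hL⟩
  have hS0 : S.Nonempty := ⟨0, [], fun i hi => absurd hi (Nat.not_lt_zero i), rfl⟩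
  obtain ⟨L, hL, hlen⟩ := Nat.sSup_mem hS0 hS
  have hbase : IsIrredundantBase G L := by
    refine ⟨hL, ?_⟩
    by_contra hne
    obtain ⟨g, hg, hg1⟩ := (Subgroup.bot_or_exists_ne_one _).resolve_left hne
    obtain ⟨ω, hω⟩ : ∃ ω, g ω ≠ ω := by
      by_contra hcon
      push Not at hcon
      exact hg1 (Equiv.ext hcon)
    have hL' : IsIrredundantSeq G (L ++ [ω]) := by
      intro i hi
      rw [List.length_append, List.length_singleton] at hi
      rcases Nat.lt_or_ge i L.length with hlt | hge
      · rw [List.take_append_of_le_length (by omega), List.take_append_of_le_length (by omega)]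
        exact hL i hlt
      · obtain rfl : i = L.length := by omega
        rw [List.take_left, List.take_of_length_le (by simp)]
        refine lt_of_le_of_ne (fun x hx => ⟨hx.1, fun y hy => hx.2 y (by simp [hy])⟩) fun heq => ?_
        rw [← heq] at hg
        exact hω (hg.2 ω (by simp))
    have hle := le_csSup hS ⟨L ++ [ω], hL', rfl⟩
    rw [List.length_append, List.length_singleton, hlen] at hle
    omega
  have hT : BddAbove {l : ℕ | ∃ L : List Ω, IsIrredundantBase G L ∧ L.length = l} :=
    ⟨Fintype.card Ω, by rintro _ ⟨L, hL, rfl⟩; exact hbd L hL.1⟩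
  exact ⟨Nat.sSup_mem ⟨_, L, hbase, rfl⟩ hT, fun l hl => le_csSup hT hl⟩

end Bases

/-! ### Socles and almost simple groups -/

/-- A minimal normal subgroup: minimal among the nontrivial normal subgroups. -/
def IsMinimalNormal {G : Type*} [Group G] (N : Subgroup G) : Prop :=
  Minimal (fun K : Subgroup G => K.Normal ∧ K ≠ ⊥) N

/-- The socle of a group: the subgroup generated by all of its minimal normal subgroups. -/
def groupSocle (G : Type*) [Group G] : Subgroup G :=
  sSup {N : Subgroup G | IsMinimalNormal N}

/-- `G` is almost simple: for some nonabelian simple group `S`, it is isomorphic to a group `A`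
with `Inn S ≤ A ≤ Aut S`. -/
def IsAlmostSimple.{u} (G : Type u) [Group G] : Prop :=
  ∃ (S : Type u) (_ : Group S), IsSimpleGroup S ∧ (∃ a b : S, a * b ≠ b * a) ∧
    ∃ A : Subgroup (MulAut S), (MulAut.conj : S →* MulAut S).range ≤ A ∧ Nonempty (G ≃* A)

/-! ### The action of `PSL(V)` on the `m`-subspaces of `V` -/

section Subspaces

variable (F V : Type*) [Field F] [AddCommGroup V] [Module F V]

/-- The set `PG_m(V)` of all `m`-dimensional subspaces of `V`. -/
def SubspacesOfDim (m : ℕ) : Type _ := {U : Submodule F V // Module.finrank F U = m}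

/-- `PSL(V) = SL(V) / Z(SL(V))`, that is, `PSL_d(q)` for `d = dim V` and `q = |F|`. -/
abbrev PSLGroup : Type _ := SpecialLinearGroup F V ⧸ Subgroup.center (SpecialLinearGroup F V)

variable {F V} in
/-- The permutation `U ↦ g U` of the set of `m`-subspaces induced by an invertible linear map. -/
def permSubspaces (m : ℕ) (g : V ≃ₗ[F] V) : Equiv.Perm (SubspacesOfDim F V m) where
  toFun U := ⟨U.1.map (g : V →ₗ[F] V), by rw [LinearEquiv.finrank_map_eq g U.1]; exact U.2⟩
  invFun U := ⟨U.1.map (g.symm : V →ₗ[F] V), by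
    rw [LinearEquiv.finrank_map_eq g.symm U.1]; exact U.2⟩
  left_inv U := Subtype.ext <| by
    simp only [← Submodule.map_comp, LinearEquiv.symm_comp, Submodule.map_id]
  right_inv U := Subtype.ext <| by
    simp only [← Submodule.map_comp, LinearEquiv.comp_symm, Submodule.map_id]

/-- The natural action of `SL(V)` on the set of `m`-subspaces of `V`. -/
def slToPermSubspaces (m : ℕ) :
    SpecialLinearGroup F V →* Equiv.Perm (SubspacesOfDim F V m) where
  toFun g := permSubspaces m g.1
  map_one' := Equiv.ext fun U => Subtype.ext (Submodule.map_id U.1)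
  map_mul' g h := Equiv.ext fun U =>
    Subtype.ext (Submodule.map_comp (h.1 : V →ₗ[F] V) (g.1 : V →ₗ[F] V) U.1)

/-- The centre of `SL(V)` consists of scalars and so fixes every subspace. -/
theorem center_le_ker_slToPermSubspaces [FiniteDimensional F V] (m : ℕ) :
    Subgroup.center (SpecialLinearGroup F V) ≤ (slToPermSubspaces F V m).ker := by
  intro g hg
  obtain ⟨r, -, hr⟩ := SpecialLinearGroup.mem_center_iff.1 hg
  have hle : ∀ U : Submodule F V, U.map ((g : V ≃ₗ[F] V) : V →ₗ[F] V) ≤ U := by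
    intro U
    rw [hr]
    rintro _ ⟨u, hu, rfl⟩
    exact U.smul_mem r hu
  rw [MonoidHom.mem_ker]
  refine Equiv.ext fun U => Subtype.ext ?_
  exact Submodule.eq_of_le_of_finrank_eq (hle U.1) (LinearEquiv.finrank_map_eq (g : V ≃ₗ[F] V) U.1)

/-- The natural action of `PSL(V)` on the set of `m`-subspaces of `V`. -/
def pslToPermSubspaces [FiniteDimensional F V] (m : ℕ) :
    PSLGroup F V →* Equiv.Perm (SubspacesOfDim F V m) :=
  QuotientGroup.lift _ (slToPermSubspaces F V m) (center_le_ker_slToPermSubspaces F V m)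

end Subspaces

/-! ### Linear maps acting on the `m`-subspaces -/

section LinearAction

open Module

variable {F V : Type*} [Field F] [AddCommGroup V] [Module F V]

/-! Write d = dim V, q = |F|, n = |Ω|, and let N be the normaliser in Sym(Ω) of the image of SL(V).
The socle is normal in G, so G ≤ N; almost simplicity is needed only to give Ω two points, that is,
0 < m < d. The bound then holds for irredundant sequences of every subgroup of N, and rests on three
facts.

The image K of GL(V) has index at most 2r in N, where r is the number of field endomorphisms of F
(`relIndex_range_permHom_normalizer_le`). Transvections are recognised group-theoretically as
central elements of Sylow subgroups for the characteristic, so N permutes them. Maximal families of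
commuting transvections whose products are again transvections or trivial are those with a common
centre or a common axis, so N permutes the points and hyperplanes together. A subgroup of index at
most 2 preserves the two types. Its elements act semilinearly on the transvections with a fixed
centre, and those with trivial field part lie in K.

Along a chain of stabilisers H, let A be the space of endomorphisms preserving the chosen subspaces
and S the sum of these subspaces (`IsIrredundantSeq.two_pow_length_le`). A step either leaves A,
hence K ∩ H, unchanged, and then |H : K ∩ H| is at least halved; or it shrinks A, and then the
potential dim A + (d - m - 1) dim S falls. The potential starts at d² and never goes below (d - m -
1) d + 1, so a sequence of length l has 2^l ≤ 2r · 2^((m+1)d - 1). The weight on dim S is what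
replaces d² by (m+1)d in the exponent.

Finally n > q^(m(d-m)) and 2^r ≤ q, so for 2m ≤ d elementary arithmetic gives r · 2^((m+1)d) < n³
(`mul_two_pow_lt_cube`). For 2m ≥ d the same argument is applied to annihilators in the dual space.
-/

theorem exists_le_le_finrank_eq [FiniteDimensional F V] {A B : Submodule F V} (hAB : A ≤ B) {m : ℕ}
    (hA : finrank F A ≤ m) (hB : m ≤ finrank F B) :
    ∃ W : Submodule F V, A ≤ W ∧ W ≤ B ∧ finrank F W = m := by
  obtain ⟨k, rfl⟩ := Nat.exists_eq_add_of_le hA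
  clear hA
  induction k generalizing A with
  | zero => exact ⟨A, le_rfl, hAB, rfl⟩
  | succ k ih =>
    obtain ⟨v, hvB, hvA⟩ : ∃ v ∈ B, v ∉ A := by
      by_contra hcon
      push Not at hcon
      have := Submodule.finrank_mono (R := F) (show B ≤ A from hcon)
      omega
    have hr := Submodule.finrank_sup_span_singleton (K := F) hvA
    obtain ⟨W, h1, h2, h3⟩ := ih (A := A ⊔ Submodule.span F {v})
      (sup_le hAB ((Submodule.span_singleton_le_iff_mem _ _).2 hvB)) (by omega)
    exact ⟨W, le_sup_left.trans h1, h2, by omega⟩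

/-- Any subspace of dimension m between the span of v and a hyperplane containing v but not w will
do. Hence a map fixing all m-subspaces has every vector as an eigenvector. -/
theorem exists_mem_notMem_finrank_eq [FiniteDimensional F V] {m : ℕ} (h0 : 0 < m)
    (h1 : m < finrank F V) {v w : V} (hw : w ∉ Submodule.span F {v}) :
    ∃ W : Submodule F V, finrank F W = m ∧ v ∈ W ∧ w ∉ W := by
  obtain ⟨φ, hφ, hle⟩ := Submodule.exists_le_ker_of_notMem hw
  have hker : finrank F (LinearMap.ker φ) + 1 = finrank F V := by
    refine Module.Dual.finrank_ker_add_one_of_ne_zero ?_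
    rintro rfl
    exact hφ rfl
  obtain ⟨W, hW1, hW2, hW3⟩ := exists_le_le_finrank_eq hle (m := m)
    ((finrank_span_le_card {v}).trans (by simpa using Nat.succ_le_of_lt h0)) (by omega)
  exact ⟨W, hW3, hW1 (Submodule.mem_span_singleton_self v), fun h => hφ (hW2 h)⟩

/-- A linear endomorphism for which every vector is an eigenvector is a scalar. -/
theorem exists_eq_smul_of_forall_mem_span (f : V →ₗ[F] V)
    (hf : ∀ v, f v ∈ Submodule.span F {v}) : ∃ c : F, ∀ x, f x = c • x := by
  obtain ⟨a, ha⟩ := LinearMap.exists_eq_smul_id_of_forall_notLinearIndependent (f := f) (by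
    intro v hv
    have := hf v
    obtain ⟨a, ha⟩ := Submodule.mem_span_singleton.1 this
    have := LinearIndependent.pair_iff.1 hv a (-1) (by rw [ha]; simp)
    simp at this)
  exact ⟨a, fun x => by simp [ha]⟩

/-- The action of the general linear group on the set of `m`-subspaces. -/
def permHom (m : ℕ) : (V ≃ₗ[F] V) →* Equiv.Perm (SubspacesOfDim F V m) where
  toFun g := permSubspaces m g
  map_one' := Equiv.ext fun U => Subtype.ext (Submodule.map_id U.1)
  map_mul' g h := Equiv.ext fun U =>
    Subtype.ext (Submodule.map_comp (h : V →ₗ[F] V) (g : V →ₗ[F] V) U.1)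

variable {m : ℕ}

theorem apply_mem_permHom (g : V ≃ₗ[F] V) (W : SubspacesOfDim F V m) {x : V} (hx : x ∈ W.1) :
    g x ∈ (permHom m g W).1 := ⟨x, hx, rfl⟩

theorem permHom_apply_eq_iff [FiniteDimensional F V] (g : V ≃ₗ[F] V) (W : SubspacesOfDim F V m) :
    permHom m g W = W ↔ ∀ x ∈ W.1, g x ∈ W.1 := by
  constructor
  · intro h x hx
    rw [← h]
    exact apply_mem_permHom g W hx
  · intro h
    refine Subtype.ext (Submodule.eq_of_le_of_finrank_eq ?_ ?_)
    · rintro _ ⟨x, hx, rfl⟩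
      exact h x hx
    · exact LinearEquiv.finrank_map_eq g W.1

variable [FiniteDimensional F V]

theorem permHom_eq_one_iff (h0 : 0 < m) (h1 : m < finrank F V) (g : V ≃ₗ[F] V) :
    permHom m g = 1 ↔ ∃ c : F, ∀ x, g x = c • x := by
  constructor
  · intro h
    refine exists_eq_smul_of_forall_mem_span (g : V →ₗ[F] V) fun v => ?_
    by_contra hv
    obtain ⟨W, hW, hvW, hgW⟩ := exists_mem_notMem_finrank_eq h0 h1 hv
    have := (permHom_apply_eq_iff g ⟨W, hW⟩).1 (by rw [h]; rfl) v hvW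
    exact hgW this
  · rintro ⟨c, hc⟩
    refine Equiv.ext fun W => (permHom_apply_eq_iff g W).2 fun x hx => ?_
    rw [hc]
    exact W.1.smul_mem c hx

theorem permHom_eq_iff (h0 : 0 < m) (h1 : m < finrank F V) (g h : V ≃ₗ[F] V) :
    permHom m g = permHom m h ↔ ∃ c : F, c ≠ 0 ∧ ∀ x, g x = c • h x := by
  have : permHom m g = permHom m h ↔ permHom m (h⁻¹ * g) = 1 := by
    rw [map_mul, map_inv, inv_mul_eq_one, eq_comm]
  rw [this, permHom_eq_one_iff h0 h1]
  constructor
  · rintro ⟨c, hc⟩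
    have hg : ∀ x, g x = c • h x := fun x => by
      have := congrArg h (hc x)
      rw [map_smul] at this
      rw [← this]
      exact (h.apply_symm_apply (g x)).symm
    refine ⟨c, ?_, hg⟩
    rintro rfl
    obtain ⟨v, hv⟩ : ∃ v : V, v ≠ 0 := by
      have : Nontrivial V := Module.nontrivial_of_finrank_pos (R := F) (by omega)
      exact exists_ne 0
    have := hg v
    rw [zero_smul, LinearEquiv.map_eq_zero_iff] at this
    exact hv this
  · rintro ⟨c, -, hc⟩
    refine ⟨c, fun x => ?_⟩
    change h.symm (g x) = _
    rw [hc, map_smul, LinearEquiv.symm_apply_apply]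

/-! ### Transvections -/

open Classical in
/-- The permutation of the `m`-subspaces induced by the transvection `x ↦ x + φ x • v`
(the identity unless `φ v = 0`). -/
noncomputable def transvPerm (m : ℕ) (φ : Dual F V) (v : V) :
    Equiv.Perm (SubspacesOfDim F V m) :=
  if h : φ v = 0 then permHom m (LinearEquiv.transvection h) else 1

omit [FiniteDimensional F V] in
theorem transvPerm_eq {φ : Dual F V} {v : V} (h : φ v = 0) :
    transvPerm m φ v = permHom m (LinearEquiv.transvection h) := dif_pos h

omit [FiniteDimensional F V] in
theorem transvPerm_zero_right (φ : Dual F V) : transvPerm m φ (0 : V) = 1 := by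
  rw [transvPerm_eq (map_zero φ), LinearEquiv.transvection.of_right_eq_zero]
  exact map_one _

omit [FiniteDimensional F V] in
theorem transvPerm_zero_left (v : V) : transvPerm m (0 : Dual F V) v = 1 := by
  rw [transvPerm_eq rfl, LinearEquiv.transvection.of_left_eq_zero]
  exact map_one _

omit [FiniteDimensional F V] in
theorem transvPerm_mul_left {φ ψ : Dual F V} {v : V} (h : φ v = 0) (h' : ψ v = 0) :
    transvPerm m φ v * transvPerm m ψ v = transvPerm m (φ + ψ) v := by
  rw [transvPerm_eq h, transvPerm_eq h', ← map_mul,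
    transvPerm_eq (show (φ + ψ) v = 0 by simp [h, h'])]
  exact congrArg _ (LinearEquiv.transvection.trans_of_right_eq h h' (by simp [h, h']))

omit [FiniteDimensional F V] in
theorem transvPerm_mul_right {φ : Dual F V} {v w : V} (h : φ v = 0) (h' : φ w = 0) :
    transvPerm m φ v * transvPerm m φ w = transvPerm m φ (v + w) := by
  rw [transvPerm_eq h, transvPerm_eq h', ← map_mul,
    transvPerm_eq (show φ (v + w) = 0 by simp [h, h'])]
  exact congrArg _ (LinearEquiv.transvection.trans_of_left_eq h h' (by simp [h, h']))

omit [FiniteDimensional F V] in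
theorem transvPerm_smul_left (a : F) (φ : Dual F V) (v : V) :
    transvPerm m (a • φ) v = transvPerm m φ (a • v) := by
  by_cases h : φ v = 0
  · rw [transvPerm_eq (show φ (a • v) = 0 by simp [h]),
      transvPerm_eq (show (a • φ) v = 0 by simp [h])]
    congr 1
    ext x
    simp [LinearMap.transvection.apply, smul_smul, mul_comm]
  · by_cases ha : a = 0
    · rw [ha, zero_smul, zero_smul, transvPerm_zero_left, transvPerm_zero_right]
    · rw [transvPerm, transvPerm, dif_neg (by simp [ha, h]), dif_neg (by simp [ha, h])]

omit [FiniteDimensional F V] in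
theorem permHom_conj_transvPerm (g : V ≃ₗ[F] V) {φ : Dual F V} {v : V} (h : φ v = 0) :
    permHom m g * transvPerm m φ v * (permHom m g)⁻¹ =
      transvPerm m (φ ∘ₗ (g.symm : V →ₗ[F] V)) (g v) := by
  rw [transvPerm_eq h, transvPerm_eq (show (φ ∘ₗ (g.symm : V →ₗ[F] V)) (g v) = 0 by simp [h]),
    ← map_inv, ← map_mul, ← map_mul]
  congr 1
  ext x
  change g (g.symm x + φ (g.symm x) • v) = x + φ (g.symm x) • g v
  simp

/-- If `1 + N` with `N² = 0` is a scalar multiple of a transvection then the scalar is `1`. -/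
theorem scalar_eq_one_of_sq_zero (hd : 2 ≤ finrank F V) (N : V →ₗ[F] V) (hN : ∀ x, N (N x) = 0)
    (φ : Dual F V) (w : V) (c : F) (h : ∀ x, x + N x = c • (x + φ x • w)) : c = 1 := by
  -- As d ≥ 2, φ kills some nonzero x; there N acts as the scalar c - 1, and N² = 0 forces c = 1.
  obtain ⟨x, hx, hx0⟩ : ∃ x ∈ LinearMap.ker φ, x ≠ 0 := by
    refine Submodule.exists_mem_ne_zero_of_ne_bot fun hbot => ?_
    have h1 := LinearMap.finrank_range_add_finrank_ker φ
    have h2 := (LinearMap.range φ).finrank_le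
    rw [hbot, finrank_bot] at h1
    rw [finrank_self] at h2
    omega
  have h1 : N x = (c - 1) • x := by
    have := h x
    rw [LinearMap.mem_ker.1 hx, zero_smul, add_zero] at this
    rw [sub_smul, one_smul, ← this]
    simp
  have h2 := hN x
  rw [h1, map_smul, h1, smul_smul, smul_eq_zero] at h2
  have h3 := h2.resolve_right hx0
  exact sub_eq_zero.1 (mul_self_eq_zero.1 h3)

/-- A permutation determines its linear map only up to a scalar; for transvections
`scalar_eq_one_of_sq_zero` removes this ambiguity. -/
theorem transvPerm_eq_iff (h0 : 0 < m) (h1 : m < finrank F V) {φ ψ : Dual F V} {v w : V}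
    (h : φ v = 0) (h' : ψ w = 0) :
    transvPerm m φ v = transvPerm m ψ w ↔ ∀ x, φ x • v = ψ x • w := by
  rw [transvPerm_eq h, transvPerm_eq h', permHom_eq_iff h0 h1]
  constructor
  · rintro ⟨c, -, hc⟩
    have hc' : ∀ x, x + φ x • v = c • (x + ψ x • w) := hc
    have : c = 1 := scalar_eq_one_of_sq_zero (by omega) (φ.smulRight v) (by simp [h]) ψ w c hc'
    intro x
    have := hc' x
    rw [‹c = 1›, one_smul] at this
    exact add_left_cancel this
  · intro hx
    refine ⟨1, one_ne_zero, fun x => ?_⟩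
    change x + φ x • v = (1 : F) • (x + ψ x • w)
    rw [hx, one_smul]

theorem transvPerm_eq_one_iff (h0 : 0 < m) (h1 : m < finrank F V) {φ : Dual F V} {v : V}
    (h : φ v = 0) : transvPerm m φ v = 1 ↔ φ = 0 ∨ v = 0 := by
  constructor
  · intro h2
    rw [← transvPerm_zero_right 0, transvPerm_eq_iff h0 h1 h (map_zero _)] at h2
    by_contra! hcon
    refine hcon.1 (LinearMap.ext fun x => ?_)
    have := h2 x
    rw [smul_zero, smul_eq_zero] at this
    exact this.resolve_right hcon.2
  · rintro (rfl | rfl)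
    · exact transvPerm_zero_left v
    · exact transvPerm_zero_right φ

omit [FiniteDimensional F V] in
theorem exists_smul_of_rankOne_eq {φ ψ : Dual F V} {v w : V} (hφ : φ ≠ 0) (hv : v ≠ 0)
    (h : ∀ x, φ x • v = ψ x • w) : ∃ a : F, a ≠ 0 ∧ v = a • w ∧ ψ = a • φ := by
  obtain ⟨x, hx⟩ := DFunLike.ne_iff.1 hφ
  rw [LinearMap.zero_apply] at hx
  have hv' : v = ((φ x)⁻¹ * ψ x) • w := by
    rw [mul_smul, ← h, smul_smul, inv_mul_cancel₀ hx, one_smul]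
  have ha : (φ x)⁻¹ * ψ x ≠ 0 := by
    intro ha
    rw [ha, zero_smul] at hv'
    exact hv hv'
  have hw : w ≠ 0 := by
    rintro rfl
    rw [smul_zero] at hv'
    exact hv hv'
  refine ⟨_, ha, hv', LinearMap.ext fun y => ?_⟩
  have := h y
  rw [hv', smul_smul] at this
  have := smul_left_injective F hw this
  simp only [LinearMap.smul_apply, smul_eq_mul]
  rw [← this, mul_comm]

/-- The image of the special linear group in the symmetric group on the `m`-subspaces. -/
abbrev slImage (F V : Type*) [Field F] [AddCommGroup V] [Module F V] (m : ℕ) :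
    Subgroup (Equiv.Perm (SubspacesOfDim F V m)) :=
  (slToPermSubspaces F V m).range

omit [FiniteDimensional F V] in
theorem mem_slImage_iff {p : Equiv.Perm (SubspacesOfDim F V m)} :
    p ∈ slImage F V m ↔ ∃ s : V ≃ₗ[F] V, LinearEquiv.det s = 1 ∧ permHom m s = p :=
  ⟨fun ⟨s, hs⟩ => ⟨s.1, s.2, hs⟩, fun ⟨s, hs, h⟩ => ⟨⟨s, hs⟩, h⟩⟩

omit [FiniteDimensional F V] in
theorem transvPerm_mem_slImage {φ : Dual F V} {v : V} (h : φ v = 0) :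
    transvPerm m φ v ∈ slImage F V m :=
  mem_slImage_iff.2 ⟨_, LinearEquiv.transvection.det_eq_one h, (transvPerm_eq h).symm⟩

omit [FiniteDimensional F V] in
theorem permHom_mem_normalizer (g : V ≃ₗ[F] V) :
    permHom m g ∈ Subgroup.normalizer (slImage F V m : Set _) := by
  have key : ∀ (g : V ≃ₗ[F] V) p, p ∈ slImage F V m →
      permHom m g * p * (permHom m g)⁻¹ ∈ slImage F V m := by
    intro g p hp
    obtain ⟨s, hs, rfl⟩ := mem_slImage_iff.1 hp
    exact mem_slImage_iff.2 ⟨g * s * g⁻¹, by simp [hs], by simp⟩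
  refine Subgroup.mem_normalizer_iff.2 fun p => ⟨key g p, fun h => ?_⟩
  have := key g⁻¹ _ h
  rw [map_inv] at this
  simpa [mul_assoc] using this

/-- The image of the special linear group has trivial centraliser. -/
theorem eq_one_of_commute_slImage {c : Equiv.Perm (SubspacesOfDim F V m)}
    (hc : ∀ p ∈ slImage F V m, c * p = p * c) : c = 1 := by
  refine Equiv.ext fun W => ?_
  by_contra hne
  change c W ≠ W at hne
  have hle : ¬ W.1 ≤ (c W).1 := fun hle =>
    hne (Subtype.ext (Submodule.eq_of_le_of_finrank_eq hle (W.2.trans (c W).2.symm))).symm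
  have hle' : ¬ (c W).1 ≤ W.1 := fun hle =>
    hne (Subtype.ext (Submodule.eq_of_le_of_finrank_eq hle ((c W).2.trans W.2.symm)))
  -- With v in W but not in c W, w in c W but not in W, and φ vanishing on W but not at w, the
  -- transvection x + φ x • v fixes W and moves c W, which is impossible if it commutes with c.
  obtain ⟨v, hv, hv'⟩ := SetLike.not_le_iff_exists.1 hle
  obtain ⟨w, hw, hw'⟩ := SetLike.not_le_iff_exists.1 hle'
  obtain ⟨φ, hφ, hφW⟩ := Submodule.exists_le_ker_of_notMem hw'
  have hφv : φ v = 0 := hφW hv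
  have hfix : transvPerm m φ v W = W := by
    rw [transvPerm_eq hφv, permHom_apply_eq_iff]
    intro x hx
    change x + φ x • v ∈ W.1
    rw [show φ x = 0 from hφW hx, zero_smul, add_zero]
    exact hx
  have hfix' : transvPerm m φ v (c W) = c W := by
    have := congrArg (fun p : Equiv.Perm _ => p W) (hc _ (transvPerm_mem_slImage (m := m) hφv))
    simp only [Equiv.Perm.mul_apply, hfix] at this
    exact this.symm
  rw [transvPerm_eq hφv, permHom_apply_eq_iff] at hfix'
  have h1 : w + φ w • v ∈ (c W).1 := hfix' w hw
  have h2 := (Submodule.add_mem_iff_right _ hw).1 h1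
  exact hv' ((Submodule.smul_mem_iff _ hφ).1 h2)

end LinearAction

/-! ### Transitivity of the general linear group -/

section Transitivity

open Module

variable {F V : Type*} [Field F] [AddCommGroup V] [Module F V]

theorem exists_ne_zero_and_ne_zero {f g : Dual F V} (hf : f ≠ 0) (hg : g ≠ 0) :
    ∃ x, f x ≠ 0 ∧ g x ≠ 0 := by
  obtain ⟨x, hx⟩ := DFunLike.ne_iff.1 hf
  obtain ⟨y, hy⟩ := DFunLike.ne_iff.1 hg
  rw [LinearMap.zero_apply] at hx hy
  by_cases h1 : g x = 0
  · by_cases h2 : f y = 0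
    · exact ⟨x + y, by simpa [h2], by simpa [h1]⟩
    · exact ⟨y, h2, hy⟩
  · exact ⟨x, hx, h1⟩

theorem exists_dual_apply_ne_zero {v : V} (hv : v ≠ 0) : ∃ φ : Dual F V, φ v ≠ 0 := by
  by_contra! h
  exact hv ((forall_dual_apply_eq_zero_iff F v).1 h)

theorem exists_linearEquiv_comp_eq {φ ψ : Dual F V} (hφ : φ ≠ 0) (hψ : ψ ≠ 0) :
    ∃ g : V ≃ₗ[F] V, φ ∘ₗ (g : V →ₗ[F] V) = ψ ∧ ∀ x, φ x = ψ x → g x = x := by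
  obtain ⟨w, hw, hw'⟩ := exists_ne_zero_and_ne_zero hφ hψ
  have hu : IsUnit (1 + (ψ - φ) ((φ w)⁻¹ • w)) := by
    have : 1 + (φ w)⁻¹ * (ψ w - φ w) = (φ w)⁻¹ * ψ w := by
      field_simp
      ring
    simp [this, hw, hw']
  refine ⟨LinearEquiv.dilatransvection hu, LinearMap.ext fun x => ?_, fun x hx => ?_⟩
  · rw [LinearMap.comp_apply, LinearEquiv.coe_coe, LinearEquiv.dilatransvection.apply]
    simp [hw]
  · rw [LinearEquiv.dilatransvection.apply]
    simp [hx]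

theorem exists_linearEquiv_apply_eq {v w : V} (hv : v ≠ 0) (hw : w ≠ 0) :
    ∃ g : V ≃ₗ[F] V, g v = w := by
  obtain ⟨φ, h1, h2⟩ := exists_ne_zero_and_ne_zero (F := F) (V := Dual F V)
    (f := Dual.eval F V v) (g := Dual.eval F V w)
    (fun h => hv ((eval_apply_eq_zero_iff F v).1 h))
    (fun h => hw ((eval_apply_eq_zero_iff F w).1 h))
  rw [Dual.eval_apply] at h1 h2
  have hu : IsUnit (1 + ((φ v)⁻¹ • φ) (w - v)) := by
    have : 1 + (φ v)⁻¹ * (φ w - φ v) = (φ v)⁻¹ * φ w := by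
      field_simp
      ring
    simp [this, h1, h2]
  refine ⟨LinearEquiv.dilatransvection hu, ?_⟩
  rw [LinearEquiv.dilatransvection.apply]
  simp [h1]

/-- After v is moved to w, the transported form and ψ both vanish at w, so the map of
`exists_linearEquiv_comp_eq` matching the forms fixes w. This makes GL(V) transitive on nontrivial
transvections. -/
theorem exists_linearEquiv_flag {φ ψ : Dual F V} {v w : V} (hφ : φ ≠ 0) (hψ : ψ ≠ 0) (hv : v ≠ 0)
    (hw : w ≠ 0) (h : φ v = 0) (h' : ψ w = 0) :
    ∃ g : V ≃ₗ[F] V, g v = w ∧ φ ∘ₗ (g.symm : V →ₗ[F] V) = ψ := by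
  obtain ⟨g, hg⟩ := exists_linearEquiv_apply_eq (F := F) hv hw
  have hne : φ ∘ₗ (g.symm : V →ₗ[F] V) ≠ 0 := by
    intro h0
    refine hφ (LinearMap.ext fun x => ?_)
    simpa using congrArg (fun f : Dual F V => f (g x)) h0
  obtain ⟨l, hl, hl'⟩ := exists_linearEquiv_comp_eq hψ hne
  refine ⟨g.trans l, ?_, LinearMap.ext fun x => ?_⟩
  · rw [LinearEquiv.trans_apply, hg]
    refine hl' _ ?_
    rw [h', ← hg]
    simp [h]
  · have := congrArg (fun f : Dual F V => f (l.symm x)) hl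
    simpa using this.symm

end Transitivity

/-! ### Transvections are preserved by the normaliser -/

/-- The Frattini argument: g carries P to a Sylow subgroup of S, which some s in S carries back to
P. -/
theorem Sylow.exists_mul_conj_mem_iff {A : Type*} [Group A] {S : Subgroup A} [Finite S] {p : ℕ}
    [Fact p.Prime] (P : Sylow p S) {g : A} (hg : g ∈ Subgroup.normalizer (S : Set A)) :
    ∃ s ∈ S, ∀ x, x ∈ (P : Subgroup S).map S.subtype ↔
      s * g * x * (s * g)⁻¹ ∈ (P : Subgroup S).map S.subtype := by
  obtain ⟨s, hs⟩ := MulAction.exists_smul_eq S ((S.normalizerMonoidHom ⟨g, hg⟩ : MulAut S) • P) P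
  have key : ∀ x : S, x ∈ (P : Subgroup S) ↔
      s * (S.normalizerMonoidHom ⟨g, hg⟩ x) * s⁻¹ ∈ (P : Subgroup S) := by
    intro x
    rw [← MulAut.conj_apply]
    conv_rhs => rw [← hs]
    rw [Sylow.smul_def]
    exact ((Subgroup.smul_mem_pointwise_smul_iff
      (a := (MulAut.conj s : MulAut S))).trans (Subgroup.smul_mem_pointwise_smul_iff
      (a := (S.normalizerMonoidHom ⟨g, hg⟩ : MulAut S)))).symm
  have hS : ∀ x, s * g * x * (s * g)⁻¹ ∈ S ↔ x ∈ S := by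
    intro x
    rw [Subgroup.mem_normalizer_iff.1 hg x]
    have : (s : A) * g * x * (s * g)⁻¹ = s * (g * x * g⁻¹) * (s : A)⁻¹ := by group
    rw [this, Subgroup.mul_mem_cancel_right S (S.inv_mem s.2), Subgroup.mul_mem_cancel_left S s.2]
  refine ⟨s, s.2, fun x => ?_⟩
  simp only [Subgroup.mem_map, Subgroup.subtype_apply, Subtype.exists, exists_and_right,
    exists_eq_right]
  constructor
  · rintro ⟨hx, hxP⟩
    refine ⟨(hS x).2 hx, ?_⟩
    convert (key ⟨x, hx⟩).1 hxP using 1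
    ext
    change (s : A) * g * x * (s * g)⁻¹ = s * (g * x * g⁻¹) * (s : A)⁻¹
    group
  · rintro ⟨hx, hxP⟩
    refine ⟨(hS x).1 hx, (key _).2 ?_⟩
    convert hxP using 1
    ext
    change (s : A) * (g * x * g⁻¹) * (s : A)⁻¹ = s * g * x * (s * g)⁻¹
    group

section TransvectionInvariance

open Module

variable {F V : Type*} [Field F] [AddCommGroup V] [Module F V] {m : ℕ}

/-- The permutations induced by nontrivial transvections. -/
def IsTransvPerm (p : Equiv.Perm (SubspacesOfDim F V m)) : Prop :=
  ∃ (φ : Dual F V) (v : V), φ ≠ 0 ∧ v ≠ 0 ∧ φ v = 0 ∧ p = transvPerm m φ v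

theorem IsTransvPerm.conj {p : Equiv.Perm (SubspacesOfDim F V m)} (hp : IsTransvPerm p)
    (g : V ≃ₗ[F] V) : IsTransvPerm (permHom m g * p * (permHom m g)⁻¹) := by
  obtain ⟨φ, v, hφ, hv, h, rfl⟩ := hp
  refine ⟨_, _, ?_, ?_, ?_, permHom_conj_transvPerm g h⟩
  · intro h0
    refine hφ (LinearMap.ext fun x => ?_)
    simpa using congrArg (fun f : Dual F V => f (g x)) h0
  · simpa using hv
  · simp [h]

variable [FiniteDimensional F V] [Finite F]

/-- The dual space has order divisible by p, so the number of fixed forms is divisible by p; since 0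
is fixed, there is another. -/
theorem IsPGroup.exists_dual_fixed {p : ℕ} [Fact p.Prime] [CharP F p] {P : Subgroup (V ≃ₗ[F] V)}
    (hP : IsPGroup p P) (hd : 0 < finrank F V) :
    ∃ φ : Dual F V, φ ≠ 0 ∧ ∀ g ∈ P, ∀ x, φ (g x) = φ x := by
  have : Finite (Dual F V) := Module.finite_of_finite F
  let _ : MulAction P (Dual F V) :=
    { smul := fun g φ => φ ∘ₗ (g.1.symm : V →ₗ[F] V)
      one_smul := fun φ => rfl
      mul_smul := fun g h φ => rfl }
  have hdvd : p ∣ Nat.card (Dual F V) := by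
    have := Fintype.ofFinite F
    obtain ⟨n, -, hn⟩ := FiniteField.card F p
    rw [Module.natCard_eq_pow_finrank (K := F), Subspace.dual_finrank_eq, Nat.card_eq_fintype_card,
      hn, ← pow_mul]
    exact dvd_pow_self p (by positivity)
  obtain ⟨φ, hφ, hφ0⟩ := hP.exists_fixed_point_of_prime_dvd_card_of_fixed_point (Dual F V) hdvd
    (a := 0) (fun g => LinearMap.ext fun x => rfl)
  refine ⟨φ, hφ0.symm, fun g hg x => ?_⟩
  have := congrArg (fun f : Dual F V => f (g x)) (hφ ⟨g, hg⟩)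
  have h2 : φ (g.symm (g x)) = φ (g x) := this
  rw [← h2, LinearEquiv.symm_apply_apply]

omit [FiniteDimensional F V] [Finite F] in
/-- A `p`-group of determinant one maps fixing a form `φ` is normalised by the transvections along
`φ`, so a Sylow subgroup contains all of these. -/
theorem Sylow.transvection_mem {p : ℕ} [Fact p.Prime] [CharP F p]
    (P : Sylow p (SpecialLinearGroup F V)) {φ : Dual F V}
    (hφ : ∀ g ∈ P, ∀ x, φ (g x) = φ x) {v : V} (h : φ v = 0) :
    (⟨LinearEquiv.transvection h, LinearEquiv.transvection.det_eq_one h⟩ :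
      SpecialLinearGroup F V) ∈ P := by
  let t : LinearMap.ker φ → SpecialLinearGroup F V := fun v =>
    ⟨LinearEquiv.transvection (LinearMap.mem_ker.1 v.2),
      LinearEquiv.transvection.det_eq_one _⟩
  have ht : ∀ v x, t v x = x + φ x • (v : V) := fun v x => rfl
  have hmul : ∀ v w, t v * t w = t (v + w) := by
    intro v w
    ext x
    change t v (t w x) = _
    simp only [ht, map_add, map_smul, LinearMap.mem_ker.1 w.2, smul_eq_mul, mul_zero, add_zero,
      Submodule.coe_add, smul_add]
    abel
  have h0 : t 0 = 1 := by
    ext x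
    change x + φ x • (0 : V) = x
    simp
  let T : Multiplicative (LinearMap.ker φ) →* SpecialLinearGroup F V :=
    { toFun := fun v => t v.toAdd
      map_one' := h0
      map_mul' := fun v w => (hmul _ _).symm }
  have hT : IsPGroup p T.range := by
    rintro ⟨_, v, rfl⟩
    refine ⟨1, Subtype.ext ?_⟩
    change T v ^ p ^ 1 = 1
    rw [pow_one, ← map_pow]
    have : v ^ p = 1 := by
      have h1 : p • v.toAdd = 0 := by
        rw [← Nat.cast_smul_eq_nsmul F, CharP.cast_eq_zero, zero_smul]
      exact h1
    rw [this, map_one]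
  have key : ∀ g ∈ P, ∀ v, ∃ w, g * T v * g⁻¹ = T w := by
    intro g hg v
    refine ⟨Multiplicative.ofAdd ⟨g v.toAdd.1, ?_⟩, ?_⟩
    · rw [LinearMap.mem_ker, hφ g hg]
      exact v.toAdd.2
    · rw [mul_inv_eq_iff_eq_mul]
      ext x
      have h2 : φ (g.1 x) = φ x := hφ g hg x
      change g.1 (x + φ x • v.toAdd.1) = g.1 x + φ (g.1 x) • g.1 v.toAdd.1
      rw [map_add, map_smul, h2]
  have hnorm : (P : Subgroup (SpecialLinearGroup F V)) ≤ Subgroup.normalizer (T.range : Set _) := by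
    intro g hg
    refine Subgroup.mem_normalizer_iff.2 fun x => ⟨?_, ?_⟩
    · rintro ⟨v, rfl⟩
      obtain ⟨w, hw⟩ := key g hg v
      exact ⟨w, hw.symm⟩
    · rintro ⟨v, hv⟩
      obtain ⟨w, hw⟩ := key g⁻¹ (inv_mem hg) v
      refine ⟨w, ?_⟩
      rw [← hw, hv]
      group
  -- P normalises the p-group of transvections along φ, so their join is a p-group, and maximality
  -- of P absorbs it.
  have hsup := P.isPGroup'.to_sup_of_normal_right' hT hnorm
  have := P.is_maximal' hsup le_sup_left
  have hle : T.range ≤ P := le_sup_right.trans this.le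
  exact hle ⟨Multiplicative.ofAdd ⟨v, h⟩, rfl⟩

/-- Every nontrivial central element of a Sylow subgroup of the image, for the characteristic p, is
a transvection. By the Frattini argument g, corrected by an element of the image of SL(V),
normalises that Sylow subgroup and so preserves its centre. -/
theorem exists_isTransvPerm_conj (h0 : 0 < m) (h1 : m < finrank F V) :
    ∃ z : Equiv.Perm (SubspacesOfDim F V m), IsTransvPerm z ∧
      ∀ g ∈ Subgroup.normalizer (slImage F V m : Set _), IsTransvPerm (g * z * g⁻¹) := by
  obtain ⟨p, hchar⟩ := CharP.exists F
  have hp : Fact p.Prime := ⟨CharP.char_is_prime F p⟩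
  have : Finite V := Module.finite_of_finite F
  have : Finite (V →ₗ[F] V) := Module.finite_of_finite F
  have : Finite (V ≃ₗ[F] V) := Finite.of_injective _ LinearEquiv.toLinearMap_injective
  have : Finite (SpecialLinearGroup F V) :=
    Finite.of_injective _ SpecialLinearGroup.toLinearEquiv_injective
  obtain ⟨P⟩ : Nonempty (Sylow p (SpecialLinearGroup F V)) := inferInstance
  have hsurj := (slToPermSubspaces F V m).rangeRestrict_surjective
  let Q : Sylow p (slImage F V m) := P.mapSurjective hsurj
  let Q' : Subgroup (Equiv.Perm (SubspacesOfDim F V m)) := Q.toSubgroup.map (Subgroup.subtype _)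
  have hQ' : ∀ x, x ∈ Q' ↔ ∃ s ∈ P, slToPermSubspaces F V m s = x := by
    intro x
    simp only [Q', Q, Sylow.coe_mapSurjective, Subgroup.map_map]
    exact Iff.rfl
  obtain ⟨φ, hφ0, hφ⟩ := IsPGroup.exists_dual_fixed (F := F) (V := V)
    (P := P.toSubgroup.map SpecialLinearGroup.toLinearEquiv) (P.isPGroup'.map _) (by omega)
  have hφP : ∀ g ∈ P, ∀ x, φ (g x) = φ x := fun g hg => hφ _ ⟨g, hg, rfl⟩
  have htv : ∀ v, φ v = 0 → transvPerm m φ v ∈ Q' := fun v hv =>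
    (hQ' _).2 ⟨_, P.transvection_mem hφP hv, (transvPerm_eq hv).symm⟩
  -- The lift s of z preserves φ, and z commutes with all transvections with axis ker φ. Hence s
  -- fixes ker φ pointwise, and a map that does so and preserves φ is a transvection along φ.
  have hcent : ∀ z ∈ Q', z ≠ 1 → (∀ y ∈ Q', y * z = z * y) → IsTransvPerm z := by
    intro z hz hz1 hcomm
    obtain ⟨s, hs, rfl⟩ := (hQ' z).1 hz
    have hfix : ∀ v, φ v = 0 → s v = v := by
      intro v hv
      have h2 := hcomm _ (htv v hv)
      have h3 := permHom_conj_transvPerm (m := m) s.1 hv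
      have h4 : permHom m s.1 * transvPerm m φ v * (permHom m s.1)⁻¹ = transvPerm m φ v := by
        rw [mul_inv_eq_iff_eq_mul]
        exact h2.symm
      have hφs : φ ∘ₗ (s.1.symm : V →ₗ[F] V) = φ := LinearMap.ext fun x => by
        have h7 := hφP s hs (s.1.symm x)
        have h6 : s (s.1.symm x) = x := s.1.apply_symm_apply x
        rw [h6] at h7
        exact h7.symm
      have hsv : φ (s v) = 0 := (hφP s hs v).trans hv
      rw [h4, hφs] at h3
      have h5 := (transvPerm_eq_iff h0 h1 hv hsv).1 h3
      obtain ⟨x, hx⟩ := DFunLike.ne_iff.1 hφ0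
      rw [LinearMap.zero_apply] at hx
      exact (smul_right_injective V hx (h5 x)).symm
    obtain ⟨u, hu⟩ := DFunLike.ne_iff.1 hφ0
    rw [LinearMap.zero_apply] at hu
    let w := (φ u)⁻¹ • (s u - u)
    have hw : φ w = 0 := by simp [w, hφP s hs u]
    have hsx : ∀ x, s x = x + φ x • w := by
      intro x
      have hk : φ (x - (φ x * (φ u)⁻¹) • u) = 0 := by simp [hu]
      have h2 := hfix _ hk
      have h3 : s (x - (φ x * (φ u)⁻¹) • u) = s x - (φ x * (φ u)⁻¹) • s u := by
        change s.1 _ = s.1 _ - _ • s.1 _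
        rw [map_sub, map_smul]
      rw [h3, sub_eq_iff_eq_add] at h2
      rw [h2]
      simp only [w, smul_smul, smul_sub]
      abel
    have heq : slToPermSubspaces F V m s = transvPerm m φ w := by
      rw [transvPerm_eq hw]
      change permHom m s.1 = _
      congr 1
      exact LinearEquiv.ext hsx
    refine ⟨φ, w, hφ0, ?_, hw, heq⟩
    intro hw0
    rw [heq, hw0, transvPerm_zero_right] at hz1
    exact hz1 rfl
  obtain ⟨z, hz, hz1, hzc⟩ : ∃ z ∈ Q', z ≠ 1 ∧ ∀ y ∈ Q', y * z = z * y := by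
    obtain ⟨v, hv, hv0⟩ : ∃ v ∈ LinearMap.ker φ, v ≠ 0 := by
      refine Submodule.exists_mem_ne_zero_of_ne_bot fun hbot => ?_
      have h2 := Module.Dual.finrank_ker_add_one_of_ne_zero hφ0
      rw [hbot, finrank_bot] at h2
      omega
    have hne : transvPerm m φ v ≠ 1 := fun h => by
      rcases (transvPerm_eq_one_iff h0 h1 hv).1 h with h | h
      · exact hφ0 h
      · exact hv0 h
    have hnt : Nontrivial Q' := ⟨⟨_, htv v hv⟩, 1, fun h => hne (congrArg Subtype.val h)⟩
    have hQp : IsPGroup p Q' := Q.isPGroup'.map _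
    have hfin : Finite Q' := Set.Finite.subset (Set.finite_range (slToPermSubspaces F V m))
      (fun x hx => by obtain ⟨s, -, rfl⟩ := (hQ' x).1 hx; exact ⟨s, rfl⟩)
    have := hQp.center_nontrivial
    obtain ⟨z, hz⟩ := exists_ne (1 : Subgroup.center Q')
    refine ⟨z.1.1, z.1.2, fun h => hz (Subtype.ext (Subtype.ext h)), fun y hy => ?_⟩
    exact congrArg Subtype.val (Subgroup.mem_center_iff.1 z.2 ⟨y, hy⟩)
  refine ⟨z, hcent z hz hz1 hzc, fun g hg => ?_⟩
  have hfinS : Finite (slImage F V m) := Set.finite_range (slToPermSubspaces F V m)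
  obtain ⟨s, hs, hconj⟩ := Q.exists_mul_conj_mem_iff hg
  have hT : IsTransvPerm (s * g * z * (s * g)⁻¹) := by
    refine hcent _ ((hconj z).1 hz) ?_ fun y hy => ?_
    · rwa [Ne, mul_inv_eq_one, mul_eq_left]
    · obtain ⟨x, rfl⟩ : ∃ x, s * g * x * (s * g)⁻¹ = y := ⟨(s * g)⁻¹ * y * (s * g), by group⟩
      have := hzc x ((hconj x).2 hy)
      calc s * g * x * (s * g)⁻¹ * (s * g * z * (s * g)⁻¹) = s * g * (x * z) * (s * g)⁻¹ := by
            group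
        _ = s * g * (z * x) * (s * g)⁻¹ := by rw [this]
        _ = _ := by group
  obtain ⟨s', -, rfl⟩ := mem_slImage_iff.1 hs
  have := hT.conj s'⁻¹
  rw [map_inv] at this
  convert this using 1
  group

/-- GL(V) is transitive on nontrivial transvections and its image lies in the normaliser, so the
single element z of `exists_isTransvPerm_conj` suffices. -/
theorem IsTransvPerm.conj_of_mem_normalizer (h0 : 0 < m) (h1 : m < finrank F V)
    {p : Equiv.Perm (SubspacesOfDim F V m)} (hp : IsTransvPerm p)
    {g : Equiv.Perm (SubspacesOfDim F V m)}
    (hg : g ∈ Subgroup.normalizer (slImage F V m : Set _)) : IsTransvPerm (g * p * g⁻¹) := by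
  obtain ⟨z, ⟨φ, v, hφ, hv, h, rfl⟩, hz⟩ := exists_isTransvPerm_conj (F := F) (V := V) h0 h1
  obtain ⟨ψ, w, hψ, hw, h', rfl⟩ := hp
  obtain ⟨l, hl, hl'⟩ := exists_linearEquiv_flag hφ hψ hv hw h h'
  have h2 := hz (g * permHom m l) (mul_mem hg (permHom_mem_normalizer l))
  have h3 := permHom_conj_transvPerm (m := m) l h
  rw [hl, hl'] at h3
  rw [← h3]
  convert h2 using 1
  group

end TransvectionInvariance

/-! ### Points and hyperplanes recovered from the transvections -/

section Cliques

open Module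
open scoped Pointwise

variable {F V : Type*} [Field F] [AddCommGroup V] [Module F V] {m : ℕ}

/-- The permutations induced by the nontrivial transvections with centre spanned by `v`. -/
def centreSet (m : ℕ) (v : V) : Set (Equiv.Perm (SubspacesOfDim F V m)) :=
  {p | ∃ φ : Dual F V, φ ≠ 0 ∧ φ v = 0 ∧ p = transvPerm m φ v}

/-- The permutations induced by the nontrivial transvections with axis `ker φ`. -/
def axisSet (m : ℕ) (φ : Dual F V) : Set (Equiv.Perm (SubspacesOfDim F V m)) :=
  {p | ∃ v : V, v ≠ 0 ∧ φ v = 0 ∧ p = transvPerm m φ v}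

/-- The sets of transvections with a common centre. -/
def IsCentreSet (A : Set (Equiv.Perm (SubspacesOfDim F V m))) : Prop :=
  ∃ v : V, v ≠ 0 ∧ A = centreSet m v

/-- The sets of transvections with a common axis. -/
def IsAxisSet (A : Set (Equiv.Perm (SubspacesOfDim F V m))) : Prop :=
  ∃ φ : Dual F V, φ ≠ 0 ∧ A = axisSet m φ

/-- Two permutations commute and their product is trivial or induced by a transvection. -/
def TransvRel (p p' : Equiv.Perm (SubspacesOfDim F V m)) : Prop :=
  p * p' = p' * p ∧ (p * p' = 1 ∨ IsTransvPerm (p * p'))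

theorem exists_dual_eq_zero_ne_zero {v w : V} (hw : w ∉ Submodule.span F {v}) :
    ∃ φ : Dual F V, φ v = 0 ∧ φ w ≠ 0 := by
  obtain ⟨φ, h1, h2⟩ := Submodule.exists_le_ker_of_notMem hw
  exact ⟨φ, h2 (Submodule.mem_span_singleton_self v), h1⟩

theorem mem_span_of_forall_dual {v w : V} (h : ∀ φ : Dual F V, φ v = 0 → φ w = 0) :
    w ∈ Submodule.span F {v} := by
  by_contra hw
  obtain ⟨φ, h1, h2⟩ := exists_dual_eq_zero_ne_zero hw
  exact h2 (h φ h1)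

theorem dual_mem_span_of_forall {φ ψ : Dual F V} (h : ∀ x, φ x = 0 → ψ x = 0) :
    ψ ∈ Submodule.span F {φ} := by
  by_cases hφ : φ = 0
  · subst hφ
    have : ψ = 0 := LinearMap.ext fun x => h x rfl
    simp [this]
  obtain ⟨u, hu⟩ := DFunLike.ne_iff.1 hφ
  rw [LinearMap.zero_apply] at hu
  refine Submodule.mem_span_singleton.2 ⟨ψ u * (φ u)⁻¹, LinearMap.ext fun x => ?_⟩
  have := h (x - (φ x * (φ u)⁻¹) • u) (by simp [hu])
  rw [map_sub, map_smul, sub_eq_zero] at this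
  rw [this]
  simp only [LinearMap.smul_apply, smul_eq_mul]
  ring

theorem centreSet_smul {a : F} (ha : a ≠ 0) (v : V) :
    centreSet (F := F) m (a • v) = centreSet m v := by
  ext p
  constructor
  · rintro ⟨φ, h1, h2, rfl⟩
    exact ⟨a • φ, smul_ne_zero ha h1, by simpa [ha] using h2, (transvPerm_smul_left a φ v).symm⟩
  · rintro ⟨φ, h1, h2, rfl⟩
    refine ⟨a⁻¹ • φ, smul_ne_zero (inv_ne_zero ha) h1, by simp [h2], ?_⟩
    rw [transvPerm_smul_left, smul_smul, inv_mul_cancel₀ ha, one_smul]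

theorem axisSet_smul {a : F} (ha : a ≠ 0) (φ : Dual F V) :
    axisSet m (a • φ) = axisSet m φ := by
  ext p
  constructor
  · rintro ⟨v, h1, h2, rfl⟩
    exact ⟨a • v, smul_ne_zero ha h1, by simpa [ha] using h2, (transvPerm_smul_left a φ v)⟩
  · rintro ⟨v, h1, h2, rfl⟩
    refine ⟨a⁻¹ • v, smul_ne_zero (inv_ne_zero ha) h1, by simp [h2], ?_⟩
    rw [transvPerm_smul_left, smul_smul, mul_inv_cancel₀ ha, one_smul]

theorem conj_centreSet (g : V ≃ₗ[F] V) (v : V) :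
    MulAut.conj (permHom m g) • centreSet (F := F) m v = centreSet m (g v) := by
  have key : ∀ (g : V ≃ₗ[F] V) (v : V),
      MulAut.conj (permHom m g) • centreSet (F := F) m v ⊆ centreSet m (g v) := by
    rintro g v _ ⟨_, ⟨φ, h1, h2, rfl⟩, rfl⟩
    refine ⟨_, ?_, ?_, permHom_conj_transvPerm g h2⟩
    · intro h0
      refine h1 (LinearMap.ext fun x => ?_)
      simpa using congrArg (fun f : Dual F V => f (g x)) h0
    · simp [h2]
  refine (key g v).antisymm ?_
  rw [Set.subset_smul_set_iff, ← map_inv, ← map_inv]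
  have := key g⁻¹ (g v)
  rwa [show g⁻¹ (g v) = v from g.symm_apply_apply v] at this

theorem conj_axisSet (g : V ≃ₗ[F] V) (φ : Dual F V) :
    MulAut.conj (permHom m g) • axisSet m φ = axisSet m (φ ∘ₗ (g.symm : V →ₗ[F] V)) := by
  have key : ∀ (g : V ≃ₗ[F] V) (φ : Dual F V),
      MulAut.conj (permHom m g) • axisSet m φ ⊆ axisSet m (φ ∘ₗ (g.symm : V →ₗ[F] V)) := by
    rintro g φ _ ⟨_, ⟨v, h1, h2, rfl⟩, rfl⟩
    exact ⟨_, by simpa using h1, by simp [h2], permHom_conj_transvPerm g h2⟩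
  refine (key g φ).antisymm ?_
  rw [Set.subset_smul_set_iff, ← map_inv, ← map_inv]
  have := key g⁻¹ (φ ∘ₗ (g.symm : V →ₗ[F] V))
  have h2 : (φ ∘ₗ (g.symm : V →ₗ[F] V)) ∘ₗ ((g⁻¹).symm : V →ₗ[F] V) = φ :=
    LinearMap.ext fun x => congrArg φ (g.symm_apply_apply x)
  rwa [h2] at this

variable [FiniteDimensional F V]

omit [FiniteDimensional F V] in
theorem exists_dual_ne_zero_eq_zero (hd : 2 ≤ finrank F V) (v : V) :
    ∃ φ : Dual F V, φ ≠ 0 ∧ φ v = 0 := by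
  obtain ⟨w, hw⟩ : ∃ w, w ∉ Submodule.span F {v} := by
    by_contra! h
    have h1 : Submodule.span F {v} = ⊤ := Submodule.eq_top_iff'.2 h
    have h2 := finrank_span_le_card (R := F) ({v} : Set V)
    rw [h1, finrank_top] at h2
    simp at h2
    omega
  obtain ⟨φ, h1, h2⟩ := exists_dual_eq_zero_ne_zero hw
  exact ⟨φ, fun h => h2 (by rw [h]; rfl), h1⟩

omit [FiniteDimensional F V] in
theorem exists_dual_ne_zero_eq_zero_eq_zero (hd : 3 ≤ finrank F V) (v w : V) :
    ∃ φ : Dual F V, φ ≠ 0 ∧ φ v = 0 ∧ φ w = 0 := by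
  classical
  obtain ⟨u, hu⟩ : ∃ u, u ∉ Submodule.span F {v, w} := by
    by_contra! h
    have h1 : Submodule.span F {v, w} = ⊤ := Submodule.eq_top_iff'.2 h
    have h2 := finrank_span_finset_le_card (R := F) ({v, w} : Finset V)
    have h3 := Finset.card_le_two (a := v) (b := w)
    rw [Set.finrank, Finset.coe_pair, h1, finrank_top] at h2
    omega
  obtain ⟨φ, h1, h2⟩ := Submodule.exists_le_ker_of_notMem hu
  exact ⟨φ, fun h => h1 (by rw [h]; rfl), h2 (Submodule.subset_span (by simp)),
    h2 (Submodule.subset_span (by simp))⟩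

theorem exists_ne_zero_apply_eq_zero (hd : 2 ≤ finrank F V) (φ : Dual F V) :
    ∃ v : V, v ≠ 0 ∧ φ v = 0 := by
  by_cases hφ : φ = 0
  · have : Nontrivial V := Module.nontrivial_of_finrank_pos (R := F) (by omega)
    obtain ⟨v, hv⟩ := exists_ne (0 : V)
    exact ⟨v, hv, by rw [hφ]; rfl⟩
  · have h2 := Module.Dual.finrank_ker_add_one_of_ne_zero hφ
    obtain ⟨v, hv, hv0⟩ : ∃ v ∈ LinearMap.ker φ, v ≠ 0 := by
      refine Submodule.exists_mem_ne_zero_of_ne_bot fun hbot => ?_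
      rw [hbot, finrank_bot] at h2
      omega
    exact ⟨v, hv0, hv⟩

section

variable (h0 : 0 < m) (h1 : m < finrank F V)
include h0 h1

theorem transvPerm_mem_centreSet_iff {φ : Dual F V} {v w : V} (hφ : φ ≠ 0) (hv : v ≠ 0)
    (h : φ v = 0) : transvPerm m φ v ∈ centreSet m w ↔ ∃ a : F, a ≠ 0 ∧ v = a • w := by
  constructor
  · rintro ⟨ψ, -, h3, h4⟩
    obtain ⟨a, ha, h5, -⟩ :=
      exists_smul_of_rankOne_eq hφ hv ((transvPerm_eq_iff h0 h1 h h3).1 h4)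
    exact ⟨a, ha, h5⟩
  · rintro ⟨a, ha, rfl⟩
    rw [← centreSet_smul ha w]
    exact ⟨φ, hφ, h, rfl⟩

theorem transvPerm_mem_axisSet_iff {φ ψ : Dual F V} {v : V} (hφ : φ ≠ 0) (hv : v ≠ 0)
    (h : φ v = 0) : transvPerm m φ v ∈ axisSet m ψ ↔ ∃ a : F, a ≠ 0 ∧ φ = a • ψ := by
  constructor
  · rintro ⟨w, -, h3, h4⟩
    obtain ⟨a, ha, -, h5⟩ :=
      exists_smul_of_rankOne_eq hφ hv ((transvPerm_eq_iff h0 h1 h h3).1 h4)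
    exact ⟨a⁻¹, inv_ne_zero ha, by rw [h5, smul_smul, inv_mul_cancel₀ ha, one_smul]⟩
  · rintro ⟨a, ha, rfl⟩
    rw [← axisSet_smul ha ψ]
    exact ⟨v, hv, h, rfl⟩

/-- Conjugation by the first transvection turns (ψ, w) into (x ↦ ψ (x - φ x • v), w + φ w • v);
equality of the rank one maps gives both conclusions. -/
theorem apply_eq_zero_of_transvPerm_commute {φ ψ : Dual F V} {v w : V} (hφ : φ ≠ 0) (hv : v ≠ 0)
    (hψ : ψ ≠ 0) (hw : w ≠ 0) (h : φ v = 0) (h' : ψ w = 0)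
    (hc : transvPerm m φ v * transvPerm m ψ w = transvPerm m ψ w * transvPerm m φ v) :
    φ w = 0 ∧ ψ v = 0 := by
  have h2 : transvPerm m φ v * transvPerm m ψ w * (transvPerm m φ v)⁻¹ = transvPerm m ψ w := by
    rw [hc, mul_inv_cancel_right]
  rw [transvPerm_eq h, permHom_conj_transvPerm _ h', eq_comm,
    transvPerm_eq_iff h0 h1 h' (by
      rw [LinearMap.comp_apply, LinearEquiv.coe_coe, LinearEquiv.symm_apply_apply, h'])] at h2
  have h3 : ∀ x, ψ x • w = ψ (x - φ x • v) • (w + φ w • v) := by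
    intro x
    rw [h2 x, LinearMap.comp_apply, LinearEquiv.coe_coe, LinearEquiv.transvection.symm_eq h (by simp [h])]
    change ψ (x + φ x • -v) • (w + φ w • v) = _
    rw [smul_neg, ← sub_eq_add_neg]
  have hφw : φ w = 0 := by
    obtain ⟨x, hx⟩ := DFunLike.ne_iff.1 hψ
    rw [LinearMap.zero_apply] at hx
    have h4 := h3 x
    by_contra hne
    have h5 : ψ (x - φ x • v) ≠ 0 := by
      intro h5
      rw [h5, zero_smul, smul_eq_zero] at h4
      exact h4.elim hx hw
    have h6 := congrArg φ h4
    simp only [map_smul, map_add, smul_eq_mul, h, mul_zero, add_zero] at h6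
    have h7 := mul_right_cancel₀ hne h6
    rw [← h7] at h4
    have h8 := smul_right_injective V hx h4
    rw [left_eq_add, smul_eq_zero] at h8
    exact h8.elim hne hv
  refine ⟨hφw, ?_⟩
  obtain ⟨x, hx⟩ := DFunLike.ne_iff.1 hφ
  rw [LinearMap.zero_apply] at hx
  have h4 := h3 x
  rw [hφw, zero_smul, add_zero] at h4
  have h5 := smul_left_injective F hw h4
  rw [map_sub, map_smul, eq_comm, sub_eq_self, smul_eq_zero] at h5
  exact h5.resolve_left hx

/-- For commuting transvections the product is 1 + φ ⊗ v + ψ ⊗ w, and the added part has rank at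
most one only if the vectors or the forms are proportional. -/
theorem transvRel_iff {φ ψ : Dual F V} {v w : V} (hφ : φ ≠ 0) (hv : v ≠ 0)
    (hψ : ψ ≠ 0) (hw : w ≠ 0) (h : φ v = 0) (h' : ψ w = 0) :
    TransvRel (transvPerm m φ v) (transvPerm m ψ w) ↔
      w ∈ Submodule.span F {v} ∨ ψ ∈ Submodule.span F {φ} := by
  constructor
  · rintro ⟨hc, ht⟩
    obtain ⟨hφw, hψv⟩ := apply_eq_zero_of_transvPerm_commute h0 h1 hφ hv hψ hw h h' hc
    obtain ⟨θ, u, hθ, ht⟩ : ∃ (θ : Dual F V) (u : V), θ u = 0 ∧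
        transvPerm m φ v * transvPerm m ψ w = transvPerm m θ u := by
      rcases ht with ht | ⟨θ, u, -, -, h2, h3⟩
      · exact ⟨0, 0, rfl, by rw [ht, transvPerm_zero_left]⟩
      · exact ⟨θ, u, h2, h3⟩
    rw [transvPerm_eq h, transvPerm_eq h', ← map_mul, transvPerm_eq hθ, permHom_eq_iff h0 h1] at ht
    obtain ⟨c, -, hc⟩ := ht
    let N : V →ₗ[F] V := φ.smulRight v + ψ.smulRight w
    have hN : ∀ x, N x = φ x • v + ψ x • w := fun x => rfl
    have hc' : ∀ x, x + N x = c • (x + θ x • u) := by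
      intro x
      rw [hN]
      have h2 : (x + ψ x • w) + φ (x + ψ x • w) • v = c • (x + θ x • u) := hc x
      rw [← h2, map_add, map_smul, hφw, smul_zero, add_zero]
      abel
    have hc1 : c = 1 := scalar_eq_one_of_sq_zero (by omega) N
      (fun x => by simp [hN, h, h', hφw, hψv]) θ u c hc'
    have key : ∀ x, φ x • v + ψ x • w = θ x • u := fun x => by
      have := hc' x
      rw [hc1, one_smul] at this
      exact add_left_cancel this
    -- A point x of ker φ outside ker ψ puts u on the line of w; a point y outside ker φ then puts v
    -- there too.
    by_contra hcon
    rw [not_or] at hcon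
    obtain ⟨x, hx, hx'⟩ : ∃ x, φ x = 0 ∧ ψ x ≠ 0 := by
      by_contra! h2
      exact hcon.2 (dual_mem_span_of_forall h2)
    obtain ⟨θ', h3, h4⟩ := exists_dual_eq_zero_ne_zero hcon.1
    have hu : θ' u ≠ 0 := by
      intro hu
      have := congrArg θ' (key x)
      rw [hx] at this
      simp [hu, hx', h4] at this
    obtain ⟨y, hy⟩ := DFunLike.ne_iff.1 hφ
    rw [LinearMap.zero_apply] at hy
    have hkx := key x
    rw [hx, zero_smul, zero_add] at hkx
    have hθx : θ x ≠ 0 := by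
      intro hz
      rw [hz, zero_smul, smul_eq_zero] at hkx
      exact hkx.elim hx' hw
    have hu' : u = ((θ x)⁻¹ * ψ x) • w := by
      rw [mul_smul, hkx, smul_smul, inv_mul_cancel₀ hθx, one_smul]
    have hky := key y
    have hv' : v = ((φ y)⁻¹ * (θ y * ((θ x)⁻¹ * ψ x) - ψ y)) • w := by
      rw [mul_smul, sub_smul, mul_smul, ← hu', ← hky, add_sub_cancel_right, smul_smul,
        inv_mul_cancel₀ hy, one_smul]
    have hb : (φ y)⁻¹ * (θ y * ((θ x)⁻¹ * ψ x) - ψ y) ≠ 0 := by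
      intro hb
      rw [hb, zero_smul] at hv'
      exact hv hv'
    refine hcon.1 (Submodule.mem_span_singleton.2 
      ⟨((φ y)⁻¹ * (θ y * ((θ x)⁻¹ * ψ x) - ψ y))⁻¹, ?_⟩)
    conv_lhs => rw [hv']
    rw [smul_smul, inv_mul_cancel₀ hb, one_smul]
  · rintro (hs | hs)
    · obtain ⟨a, rfl⟩ := Submodule.mem_span_singleton.1 hs
      have ha : a ≠ 0 := by
        rintro rfl
        simp at hw
      have hψv : (a • ψ) v = 0 := by simpa using h'
      rw [← transvPerm_smul_left, TransvRel, transvPerm_mul_left h hψv, transvPerm_mul_left hψv h]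
      refine ⟨by rw [add_comm], ?_⟩
      by_cases hsum : φ + a • ψ = 0
      · left
        rw [hsum, transvPerm_zero_left]
      · exact Or.inr ⟨_, _, hsum, hv, by simp [h, hψv], rfl⟩
    · obtain ⟨a, rfl⟩ := Submodule.mem_span_singleton.1 hs
      have ha : a ≠ 0 := by
        rintro rfl
        simp at hψ
      have hφw : φ (a • w) = 0 := by simpa using h'
      rw [transvPerm_smul_left, TransvRel, transvPerm_mul_right h hφw, transvPerm_mul_right hφw h]
      refine ⟨by rw [add_comm], ?_⟩
      by_cases hsum : v + a • w = 0
      · left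
        rw [hsum, transvPerm_zero_right]
      · exact Or.inr ⟨_, _, hφ, hsum, by rw [map_add, h, hφw, add_zero], rfl⟩

/-- If some p' does not share the centre of the first element t, it shares its axis. An element with
the centre of t can then be related to p' only through the axis, so all axes coincide. -/
theorem exists_subset_of_pairwise_transvRel {A : Set (Equiv.Perm (SubspacesOfDim F V m))}
    (hA : A.Nonempty) (hT : ∀ p ∈ A, IsTransvPerm p) (hR : ∀ p ∈ A, ∀ p' ∈ A, TransvRel p p') :
    ∃ B, (IsCentreSet B ∨ IsAxisSet B) ∧ A ⊆ B := by
  obtain ⟨t, ht⟩ := hA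
  obtain ⟨φ, v, hφ, hv, h, rfl⟩ := hT t ht
  by_cases hall : A ⊆ centreSet m v
  · exact ⟨_, Or.inl ⟨v, hv, rfl⟩, hall⟩
  refine ⟨_, Or.inr ⟨φ, hφ, rfl⟩, fun p hp => ?_⟩
  obtain ⟨p', hp', hp'A⟩ := Set.not_subset.1 hall
  obtain ⟨ψ, w, hψ, hw, h', rfl⟩ := hT p hp
  obtain ⟨θ, u, hθ, hu, h'', rfl⟩ := hT p' hp'
  have hs : ∀ {x y : V}, x ≠ 0 → x ∈ Submodule.span F {y} → ∃ a : F, a ≠ 0 ∧ x = a • y := by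
    intro x y hx hxy
    obtain ⟨a, rfl⟩ := Submodule.mem_span_singleton.1 hxy
    exact ⟨a, fun ha => hx (by rw [ha, zero_smul]), rfl⟩
  have hs' : ∀ {x y : Dual F V}, x ≠ 0 → x ∈ Submodule.span F {y} →
      ∃ a : F, a ≠ 0 ∧ x = a • y := by
    intro x y hx hxy
    obtain ⟨a, rfl⟩ := Submodule.mem_span_singleton.1 hxy
    exact ⟨a, fun ha => hx (by rw [ha, zero_smul]), rfl⟩
  have huv : u ∉ Submodule.span F {v} := fun hin =>
    hp'A ((transvPerm_mem_centreSet_iff h0 h1 hθ hu h'').2 (hs hu hin))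
  have hθφ : θ ∈ Submodule.span F {φ} :=
    ((transvRel_iff h0 h1 hφ hv hθ hu h h'').1 (hR _ ht _ hp')).resolve_left huv
  refine (transvPerm_mem_axisSet_iff h0 h1 hψ hw h').2 (hs' hψ ?_)
  rcases (transvRel_iff h0 h1 hφ hv hψ hw h h').1 (hR _ ht _ hp) with hwv | hin
  · obtain ⟨a, ha, rfl⟩ := hs' hθ hθφ
    obtain ⟨b, hb, rfl⟩ := hs hw hwv
    rcases (transvRel_iff h0 h1 hψ hw hθ hu h' h'').1 (hR _ hp _ hp') with h2 | h2
    · exact absurd (Submodule.span_singleton_smul_le F b v h2) huv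
    · obtain ⟨c, hc⟩ := Submodule.mem_span_singleton.1 h2
      have hc0 : c ≠ 0 := by
        rintro rfl
        rw [zero_smul] at hc
        exact hθ hc.symm
      refine Submodule.mem_span_singleton.2 ⟨c⁻¹ * a, ?_⟩
      rw [mul_smul, ← hc, smul_smul, inv_mul_cancel₀ hc0, one_smul]
  · exact hin

omit h0 [FiniteDimensional F V] in
theorem IsCentreSet.nonempty (hm : 0 < m) {A : Set (Equiv.Perm (SubspacesOfDim F V m))}
    (hA : IsCentreSet A) : A.Nonempty := by
  obtain ⟨v, hv, rfl⟩ := hA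
  obtain ⟨φ, h2, h3⟩ := exists_dual_ne_zero_eq_zero (F := F) (by omega) v
  exact ⟨_, φ, h2, h3, rfl⟩

omit h0 in
theorem IsAxisSet.nonempty (hm : 0 < m) {A : Set (Equiv.Perm (SubspacesOfDim F V m))}
    (hA : IsAxisSet A) : A.Nonempty := by
  obtain ⟨φ, hφ, rfl⟩ := hA
  obtain ⟨v, h2, h3⟩ := exists_ne_zero_apply_eq_zero (by omega) φ
  exact ⟨_, v, h2, h3, rfl⟩

omit h0 h1 [FiniteDimensional F V] in
theorem IsCentreSet.isTransvPerm {A : Set (Equiv.Perm (SubspacesOfDim F V m))}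
    (hA : IsCentreSet A) : ∀ p ∈ A, IsTransvPerm p := by
  obtain ⟨v, hv, rfl⟩ := hA
  rintro _ ⟨φ, h2, h3, rfl⟩
  exact ⟨φ, v, h2, hv, h3, rfl⟩

omit h0 h1 [FiniteDimensional F V] in
theorem IsAxisSet.isTransvPerm {A : Set (Equiv.Perm (SubspacesOfDim F V m))}
    (hA : IsAxisSet A) : ∀ p ∈ A, IsTransvPerm p := by
  obtain ⟨φ, hφ, rfl⟩ := hA
  rintro _ ⟨v, h2, h3, rfl⟩
  exact ⟨φ, v, hφ, h2, h3, rfl⟩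

theorem IsCentreSet.transvRel {A : Set (Equiv.Perm (SubspacesOfDim F V m))}
    (hA : IsCentreSet A) : ∀ p ∈ A, ∀ p' ∈ A, TransvRel p p' := by
  obtain ⟨v, hv, rfl⟩ := hA
  rintro _ ⟨φ, h2, h3, rfl⟩ _ ⟨ψ, h4, h5, rfl⟩
  exact (transvRel_iff h0 h1 h2 hv h4 hv h3 h5).2 (Or.inl (Submodule.mem_span_singleton_self v))

theorem IsAxisSet.transvRel {A : Set (Equiv.Perm (SubspacesOfDim F V m))}
    (hA : IsAxisSet A) : ∀ p ∈ A, ∀ p' ∈ A, TransvRel p p' := by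
  obtain ⟨φ, hφ, rfl⟩ := hA
  rintro _ ⟨v, h2, h3, rfl⟩ _ ⟨w, h4, h5, rfl⟩
  exact (transvRel_iff h0 h1 hφ h2 hφ h4 h3 h5).2 (Or.inr (Submodule.mem_span_singleton_self φ))

theorem centreSet_eq_of_mem {p : Equiv.Perm (SubspacesOfDim F V m)} {v w : V} (hv : v ≠ 0)
    (hp : p ∈ centreSet (F := F) m v) (hp' : p ∈ centreSet (F := F) m w) :
    centreSet (F := F) m v = centreSet m w := by
  obtain ⟨φ, h2, h3, rfl⟩ := hp
  obtain ⟨a, ha, rfl⟩ := (transvPerm_mem_centreSet_iff h0 h1 h2 hv h3).1 hp'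
  exact centreSet_smul ha w

theorem axisSet_eq_of_mem {p : Equiv.Perm (SubspacesOfDim F V m)} {φ ψ : Dual F V} (hφ : φ ≠ 0)
    (hp : p ∈ axisSet m φ) (hp' : p ∈ axisSet m ψ) : axisSet m φ = axisSet m ψ := by
  obtain ⟨v, h2, h3, rfl⟩ := hp
  obtain ⟨a, ha, rfl⟩ := (transvPerm_mem_axisSet_iff h0 h1 hφ h2 h3).1 hp'
  exact axisSet_smul ha ψ

/-- Centre and axis sets form an antichain, hence are exactly the maximal nonempty cliques of
`TransvRel`. The mixed cases really occur: in dimension two centre sets are axis sets. -/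
theorem eq_of_subset {A B : Set (Equiv.Perm (SubspacesOfDim F V m))}
    (hA : IsCentreSet A ∨ IsAxisSet A) (hB : IsCentreSet B ∨ IsAxisSet B) (hAB : A ⊆ B) :
    A = B := by
  have hd : 2 ≤ finrank F V := by omega
  rcases hA with ⟨v, hv, rfl⟩ | ⟨φ, hφ, rfl⟩
  · obtain ⟨φ, h2, h3⟩ := exists_dual_ne_zero_eq_zero (F := F) hd v
    have hmem := hAB ⟨φ, h2, h3, rfl⟩
    rcases hB with ⟨w, hw, rfl⟩ | ⟨ψ, hψ, rfl⟩
    · exact centreSet_eq_of_mem h0 h1 hv ⟨φ, h2, h3, rfl⟩ hmem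
    · refine hAB.antisymm ?_
      rintro _ ⟨w, hw, hψw, rfl⟩
      refine (transvPerm_mem_centreSet_iff h0 h1 hψ hw hψw).2 ?_
      have hin : w ∈ Submodule.span F {v} := by
        refine mem_span_of_forall_dual fun θ hθ => ?_
        by_cases hθ0 : θ = 0
        · rw [hθ0]; rfl
        obtain ⟨a, -, rfl⟩ := (transvPerm_mem_axisSet_iff h0 h1 hθ0 hv hθ).1
          (hAB ⟨θ, hθ0, hθ, rfl⟩)
        simp [hψw]
      obtain ⟨a, rfl⟩ := Submodule.mem_span_singleton.1 hin
      exact ⟨a, fun ha => hw (by rw [ha, zero_smul]), rfl⟩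
  · obtain ⟨v, h2, h3⟩ := exists_ne_zero_apply_eq_zero hd φ
    have hmem := hAB ⟨v, h2, h3, rfl⟩
    rcases hB with ⟨w, hw, rfl⟩ | ⟨ψ, hψ, rfl⟩
    · refine hAB.antisymm ?_
      rintro _ ⟨ψ, hψ, hψw, rfl⟩
      refine (transvPerm_mem_axisSet_iff h0 h1 hψ hw hψw).2 ?_
      have hin : ψ ∈ Submodule.span F {φ} := by
        refine dual_mem_span_of_forall fun x hx => ?_
        by_cases hx0 : x = 0
        · rw [hx0, map_zero]
        obtain ⟨a, -, rfl⟩ := (transvPerm_mem_centreSet_iff h0 h1 hφ hx0 hx).1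
          (hAB ⟨x, hx0, hx, rfl⟩)
        simp [hψw]
      obtain ⟨a, rfl⟩ := Submodule.mem_span_singleton.1 hin
      exact ⟨a, fun ha => hψ (by rw [ha, zero_smul]), rfl⟩
    · exact axisSet_eq_of_mem h0 h1 hφ ⟨v, h2, h3, rfl⟩ hmem

variable [Finite F]

/-- Conjugation preserves `TransvRel`, so it sends a clique into a maximal one; the same for g⁻¹ and
the antichain property turn the inclusion into an equality. -/
theorem isCentreSet_or_isAxisSet_conj {g : Equiv.Perm (SubspacesOfDim F V m)}
    (hg : g ∈ Subgroup.normalizer (slImage F V m : Set _))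
    {A : Set (Equiv.Perm (SubspacesOfDim F V m))} (hA : IsCentreSet A ∨ IsAxisSet A) :
    IsCentreSet (MulAut.conj g • A) ∨ IsAxisSet (MulAut.conj g • A) := by
  have key : ∀ g ∈ Subgroup.normalizer (slImage F V m : Set (Equiv.Perm (SubspacesOfDim F V m))),
      ∀ A : Set (Equiv.Perm (SubspacesOfDim F V m)), (IsCentreSet A ∨ IsAxisSet A) →
      ∃ B, (IsCentreSet B ∨ IsAxisSet B) ∧ MulAut.conj g • A ⊆ B := by
    intro g hg A hA
    have hne : A.Nonempty := hA.elim (fun h => h.nonempty h1 h0) (fun h => h.nonempty h1 h0)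
    have hT : ∀ p ∈ A, IsTransvPerm p := hA.elim (fun h => h.isTransvPerm) fun h => h.isTransvPerm
    have hR : ∀ p ∈ A, ∀ p' ∈ A, TransvRel p p' :=
      hA.elim (fun h => h.transvRel h0 h1) fun h => h.transvRel h0 h1
    refine exists_subset_of_pairwise_transvRel h0 h1 hne.smul_set ?_ ?_
    · rintro _ ⟨p, hp, rfl⟩
      exact (hT p hp).conj_of_mem_normalizer h0 h1 hg
    · rintro _ ⟨p, hp, rfl⟩ _ ⟨p', hp', rfl⟩
      obtain ⟨h2, h3⟩ := hR p hp p' hp'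
      have hmul : MulAut.conj g • p * MulAut.conj g • p' = MulAut.conj g • (p * p') :=
        (smul_mul' _ _ _).symm
      refine ⟨?_, ?_⟩
      · change MulAut.conj g • p * MulAut.conj g • p' = MulAut.conj g • p' * MulAut.conj g • p
        rw [← smul_mul', ← smul_mul', h2]
      · change MulAut.conj g • p * MulAut.conj g • p' = 1 ∨
          IsTransvPerm (MulAut.conj g • p * MulAut.conj g • p')
        rw [hmul]
        rcases h3 with h3 | h3
        · left
          rw [h3, smul_one]
        · exact Or.inr (h3.conj_of_mem_normalizer h0 h1 hg)
  obtain ⟨B, hB, hAB⟩ := key g hg A hA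
  obtain ⟨A', hA', hBA'⟩ := key g⁻¹ (inv_mem hg) B hB
  have h2 : A ⊆ MulAut.conj g⁻¹ • B := by
    rw [map_inv]
    exact Set.subset_smul_set_iff.2 (by rwa [inv_inv])
  have h3 : A = A' := eq_of_subset h0 h1 hA hA' (h2.trans hBA')
  have h4 : MulAut.conj g • A = B := by
    refine hAB.antisymm ?_
    rw [Set.subset_smul_set_iff, ← map_inv, h3]
    exact hBA'
  rwa [h4]

end

end Cliques

/-! ### The type-preserving subgroup of the normaliser -/

section TypePreserving

open Module
open scoped Pointwise

variable {F V : Type*} [Field F] [AddCommGroup V] [Module F V] {m : ℕ}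

/-- The elements of the normaliser of the special linear group that preserve the points and the
hyperplanes. -/
def typeSubgroup (F V : Type*) [Field F] [AddCommGroup V] [Module F V] (m : ℕ) :
    Subgroup (Equiv.Perm (SubspacesOfDim F V m)) where
  carrier := {g | g ∈ Subgroup.normalizer (slImage F V m : Set (Equiv.Perm (SubspacesOfDim F V m))) ∧
    ∀ A : Set (Equiv.Perm (SubspacesOfDim F V m)),
      (IsCentreSet A ↔ IsCentreSet (MulAut.conj g • A)) ∧
      (IsAxisSet A ↔ IsAxisSet (MulAut.conj g • A))}
  one_mem' := ⟨one_mem _, fun A => by simp⟩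
  mul_mem' := by
    rintro g h ⟨hg, hg'⟩ ⟨hh, hh'⟩
    refine ⟨mul_mem hg hh, fun A => ?_⟩
    rw [map_mul, mul_smul]
    exact ⟨(hh' A).1.trans (hg' _).1, (hh' A).2.trans (hg' _).2⟩
  inv_mem' := by
    rintro g ⟨hg, hg'⟩
    refine ⟨inv_mem hg, fun A => ?_⟩
    have := hg' (MulAut.conj g⁻¹ • A)
    rw [map_inv, smul_inv_smul] at this
    rw [map_inv]
    exact ⟨this.1.symm, this.2.symm⟩

theorem typeSubgroup_le_normalizer :
    typeSubgroup F V m ≤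
      Subgroup.normalizer (slImage F V m : Set (Equiv.Perm (SubspacesOfDim F V m))) :=
  fun _ h => h.1

theorem range_permHom_le_typeSubgroup :
    (permHom (F := F) (V := V) m).range ≤ typeSubgroup F V m := by
  have hc : ∀ (g : V ≃ₗ[F] V) (A : Set (Equiv.Perm (SubspacesOfDim F V m))), IsCentreSet A →
      IsCentreSet (MulAut.conj (permHom m g) • A) := by
    rintro g _ ⟨v, hv, rfl⟩
    exact ⟨g v, by simpa using hv, conj_centreSet g v⟩
  have ha : ∀ (g : V ≃ₗ[F] V) (A : Set (Equiv.Perm (SubspacesOfDim F V m))), IsAxisSet A →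
      IsAxisSet (MulAut.conj (permHom m g) • A) := by
    rintro g _ ⟨φ, hφ, rfl⟩
    refine ⟨_, fun h => hφ (LinearMap.ext fun x => ?_), conj_axisSet g φ⟩
    simpa using congrArg (fun f : Dual F V => f (g x)) h
  rintro _ ⟨g, rfl⟩
  refine ⟨permHom_mem_normalizer g, fun A => ⟨⟨hc g A, fun h => ?_⟩, ⟨ha g A, fun h => ?_⟩⟩⟩
  · have := hc g⁻¹ _ h
    rwa [map_inv, map_inv, inv_smul_smul] at this
  · have := ha g⁻¹ _ h
    rwa [map_inv, map_inv, inv_smul_smul] at this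

/-- Since `f` only has to separate left cosets, the type and the field endomorphism attached to an
element need not be shown multiplicative. -/
theorem Subgroup.relIndex_le_card {A α : Type*} [Group A] [Finite α] {H K : Subgroup A}
    (f : A → α) (hf : ∀ g ∈ K, ∀ h ∈ K, f g = f h → g⁻¹ * h ∈ H) :
    H.relIndex K ≤ Nat.card α := by
  rw [Subgroup.relIndex, Subgroup.index]
  refine Nat.card_le_card_of_injective (fun q : K ⧸ H.subgroupOf K => f q.out) fun q r hqr => ?_
  have := hf _ q.out.2 _ r.out.2 hqr
  rw [← q.out_eq, ← r.out_eq]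
  exact QuotientGroup.eq.2 (Subgroup.mem_subgroupOf.2 this)

variable [FiniteDimensional F V]

section

variable (h0 : 0 < m) (h1 : m < finrank F V)
include h0 h1

/-- Incidence of a point with a hyperplane is thus visible inside the permutation group. -/
theorem centreSet_inter_axisSet_nonempty_iff {φ : Dual F V} {v : V} (hφ : φ ≠ 0) (hv : v ≠ 0) :
    (centreSet (F := F) m v ∩ axisSet m φ).Nonempty ↔ φ v = 0 := by
  constructor
  · rintro ⟨_, ⟨ψ, h2, h3, rfl⟩, h4⟩
    obtain ⟨a, ha, rfl⟩ := (transvPerm_mem_axisSet_iff h0 h1 h2 hv h3).1 h4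
    simpa [ha] using h3
  · intro h
    exact ⟨_, ⟨φ, hφ, h, rfl⟩, ⟨v, hv, h, rfl⟩⟩

theorem not_isCentreSet_of_isAxisSet (hd : 3 ≤ finrank F V)
    {A : Set (Equiv.Perm (SubspacesOfDim F V m))} (hA : IsAxisSet A) : ¬ IsCentreSet A := by
  rintro ⟨v, hv, rfl⟩
  obtain ⟨φ, hφ, h⟩ := hA
  obtain ⟨w, hw⟩ : ∃ w, w ∉ Submodule.span F {v} ∧ φ w = 0 := by
    have h2 := Module.Dual.finrank_ker_add_one_of_ne_zero hφ
    by_contra! hcon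
    have hle : LinearMap.ker φ ≤ Submodule.span F {v} := by
      intro x hx
      by_contra hx'
      exact hcon x hx' hx
    have h3 := Submodule.finrank_mono hle
    have h4 := finrank_span_le_card (R := F) ({v} : Set V)
    simp at h4
    omega
  have hw0 : w ≠ 0 := fun h => hw.1 (by rw [h]; exact Submodule.zero_mem _)
  have hmem : transvPerm m φ w ∈ centreSet m v := by
    rw [h]
    exact ⟨w, hw0, hw.2, rfl⟩
  obtain ⟨a, -, ha⟩ := (transvPerm_mem_centreSet_iff h0 h1 hφ hw0 hw.2).1 hmem
  exact hw.1 (Submodule.mem_span_singleton.2 ⟨a, ha.symm⟩)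

/-- In dimension at least three, whether an element of the normaliser preserves the type of a set of
transvections does not depend on that set. -/
theorem type_preserved_iff [Finite F] (hd : 3 ≤ finrank F V)
    {g : Equiv.Perm (SubspacesOfDim F V m)}
    (hg : g ∈ Subgroup.normalizer (slImage F V m : Set (Equiv.Perm (SubspacesOfDim F V m))))
    {A B : Set (Equiv.Perm (SubspacesOfDim F V m))}
    (hA : IsCentreSet A ∨ IsAxisSet A) (hB : IsCentreSet B ∨ IsAxisSet B) :
    (IsCentreSet A ↔ IsCentreSet (MulAut.conj g • A)) ↔
      (IsCentreSet B ↔ IsCentreSet (MulAut.conj g • B)) := by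
  -- Distinct sets that meet have opposite types, and conjugation keeps them distinct and meeting.
  have hopp : ∀ {A B : Set (Equiv.Perm (SubspacesOfDim F V m))}, IsCentreSet A ∨ IsAxisSet A →
      IsCentreSet B ∨ IsAxisSet B → A ≠ B → (A ∩ B).Nonempty →
      (IsCentreSet A ↔ ¬ IsCentreSet B) := by
    intro A B hA hB hne hAB
    obtain ⟨p, hpA, hpB⟩ := hAB
    rcases hA with hA | hA <;> rcases hB with hB | hB
    · obtain ⟨v, hv, rfl⟩ := hA
      obtain ⟨w, hw, rfl⟩ := hB
      exact absurd (centreSet_eq_of_mem h0 h1 hv hpA hpB) hne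
    · simp [hA, not_isCentreSet_of_isAxisSet h0 h1 hd hB]
    · simp [hB, not_isCentreSet_of_isAxisSet h0 h1 hd hA]
    · obtain ⟨v, hv, rfl⟩ := hA
      obtain ⟨w, hw, rfl⟩ := hB
      exact absurd (axisSet_eq_of_mem h0 h1 hv hpA hpB) hne
  have hstep : ∀ {v : V} {φ : Dual F V}, v ≠ 0 → φ ≠ 0 → φ v = 0 →
      ((IsCentreSet (centreSet (F := F) m v) ↔
        IsCentreSet (MulAut.conj g • centreSet (F := F) m v)) ↔
      (IsCentreSet (axisSet m φ) ↔ IsCentreSet (MulAut.conj g • axisSet m φ))) := by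
    intro v φ hv hφ h
    have hA : IsCentreSet (centreSet (F := F) m v) := ⟨v, hv, rfl⟩
    have hB : IsAxisSet (axisSet m φ) := ⟨φ, hφ, rfl⟩
    have hne : centreSet (F := F) m v ≠ axisSet m φ := fun heq =>
      not_isCentreSet_of_isAxisSet h0 h1 hd hB (heq ▸ hA)
    have hint := (centreSet_inter_axisSet_nonempty_iff h0 h1 hφ hv).2 h
    have e1 := hopp (Or.inl hA) (Or.inr hB) hne hint
    have e2 := hopp (isCentreSet_or_isAxisSet_conj h0 h1 hg (Or.inl hA))
      (isCentreSet_or_isAxisSet_conj h0 h1 hg (Or.inr hB))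
      (fun h => hne (smul_left_cancel _ h)) (by
        rw [← Set.smul_set_inter]
        exact hint.smul_set)
    tauto
  -- In dimension at least three, two points lie on a common hyperplane, which links their types.
  have hcc : ∀ {v w : V}, v ≠ 0 → w ≠ 0 →
      ((IsCentreSet (centreSet (F := F) m v) ↔
        IsCentreSet (MulAut.conj g • centreSet (F := F) m v)) ↔
      (IsCentreSet (centreSet (F := F) m w) ↔
        IsCentreSet (MulAut.conj g • centreSet (F := F) m w))) := by
    intro v w hv hw
    obtain ⟨φ, hφ, h2, h3⟩ := exists_dual_ne_zero_eq_zero_eq_zero hd v w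
    exact (hstep hv hφ h2).trans (hstep hw hφ h3).symm
  have hred : ∀ A : Set (Equiv.Perm (SubspacesOfDim F V m)), IsCentreSet A ∨ IsAxisSet A →
      ∃ v : V, v ≠ 0 ∧ ((IsCentreSet A ↔ IsCentreSet (MulAut.conj g • A)) ↔
        (IsCentreSet (centreSet (F := F) m v) ↔
        IsCentreSet (MulAut.conj g • centreSet (F := F) m v))) := by
    rintro A (⟨v, hv, rfl⟩ | ⟨φ, hφ, rfl⟩)
    · exact ⟨v, hv, Iff.rfl⟩
    · obtain ⟨v, hv, h⟩ := exists_ne_zero_apply_eq_zero (by omega) φ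
      exact ⟨v, hv, (hstep hv hφ h).symm⟩
  obtain ⟨v, hv, hAv⟩ := hred A hA
  obtain ⟨w, hw, hBw⟩ := hred B hB
  exact hAv.trans ((hcc hv hw).trans hBw.symm)

/-- In a plane the kernel of a nonzero form is a line, so centre and axis determine each other. -/
theorem isCentreSet_iff_isAxisSet_of_finrank_eq_two (hd : finrank F V = 2)
    {A : Set (Equiv.Perm (SubspacesOfDim F V m))} : IsCentreSet A ↔ IsAxisSet A := by
  have key : ∀ {v : V} {φ : Dual F V}, v ≠ 0 → φ ≠ 0 → φ v = 0 →
      centreSet (F := F) m v = axisSet m φ := by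
    intro v φ hv hφ h
    refine (eq_of_subset h0 h1 (Or.inr ⟨φ, hφ, rfl⟩) (Or.inl ⟨v, hv, rfl⟩) ?_).symm
    rintro _ ⟨w, hw, hφw, rfl⟩
    refine (transvPerm_mem_centreSet_iff h0 h1 hφ hw hφw).2 ?_
    have h2 := Module.Dual.finrank_ker_add_one_of_ne_zero hφ
    have hle : Submodule.span F {v} = LinearMap.ker φ :=
      Submodule.eq_of_le_of_finrank_eq
        ((Submodule.span_singleton_le_iff_mem _ _).2 h) (by rw [finrank_span_singleton hv]; omega)
    have hin : w ∈ Submodule.span F {v} := by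
      rw [hle]
      exact hφw
    obtain ⟨a, rfl⟩ := Submodule.mem_span_singleton.1 hin
    exact ⟨a, fun ha => hw (by rw [ha, zero_smul]), rfl⟩
  constructor
  · rintro ⟨v, hv, rfl⟩
    obtain ⟨φ, hφ, h⟩ := exists_dual_ne_zero_eq_zero (F := F) hd.ge v
    exact ⟨φ, hφ, key hv hφ h⟩
  · rintro ⟨φ, hφ, rfl⟩
    obtain ⟨v, hv, h⟩ := exists_ne_zero_apply_eq_zero hd.ge φ
    exact ⟨v, hv, (key hv hφ h).symm⟩

/-- Testing the type of the image of one fixed centre set is enough: by `type_preserved_iff`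
elements with equal outcome differ by a type-preserving one, and in dimension two there is only one
type. -/
theorem relIndex_typeSubgroup_le_two [Finite F] :
    (typeSubgroup F V m).relIndex
      (Subgroup.normalizer (slImage F V m : Set (Equiv.Perm (SubspacesOfDim F V m)))) ≤ 2 := by
  classical
  have hV : Nontrivial V := Module.nontrivial_of_finrank_pos (R := F) (by omega)
  obtain ⟨e, he⟩ := exists_ne (0 : V)
  let A₀ : Set (Equiv.Perm (SubspacesOfDim F V m)) := centreSet (F := F) m e
  have hA₀ : IsCentreSet A₀ := ⟨e, he, rfl⟩
  have hcard : Nat.card Bool = 2 := by simp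
  rw [← hcard]
  refine Subgroup.relIndex_le_card (fun g => decide (IsCentreSet (MulAut.conj g • A₀))) ?_
  intro g hg h hh hgh
  rw [decide_eq_decide] at hgh
  have hk : g⁻¹ * h ∈ Subgroup.normalizer
    (slImage F V m : Set (Equiv.Perm (SubspacesOfDim F V m))) := mul_mem (inv_mem hg) hh
  have hfam : ∀ A : Set (Equiv.Perm (SubspacesOfDim F V m)), IsCentreSet A ∨ IsAxisSet A ↔
      IsCentreSet (MulAut.conj (g⁻¹ * h) • A) ∨ IsAxisSet (MulAut.conj (g⁻¹ * h) • A) := by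
    intro A
    refine ⟨isCentreSet_or_isAxisSet_conj h0 h1 hk, fun hA => ?_⟩
    have := isCentreSet_or_isAxisSet_conj h0 h1 (inv_mem hk) hA
    rwa [map_inv, inv_smul_smul] at this
  refine ⟨hk, ?_⟩
  rcases (show finrank F V = 2 ∨ 3 ≤ finrank F V by omega) with hd | hd
  · intro A
    have := hfam A
    simp only [isCentreSet_iff_isAxisSet_of_finrank_eq_two h0 h1 hd, or_self] at this ⊢
    exact ⟨this, this⟩
  · have hex : ∀ A : Set (Equiv.Perm (SubspacesOfDim F V m)), IsAxisSet A ↔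
        (IsCentreSet A ∨ IsAxisSet A) ∧ ¬ IsCentreSet A := by
      intro A
      have := not_isCentreSet_of_isAxisSet h0 h1 hd (A := A)
      tauto
    have hc : ∀ A : Set (Equiv.Perm (SubspacesOfDim F V m)), IsCentreSet A ∨ IsAxisSet A →
        (IsCentreSet A ↔ IsCentreSet (MulAut.conj (g⁻¹ * h) • A)) := by
      intro A hA
      have e1 := type_preserved_iff h0 h1 hd hh (Or.inl hA₀) hA
      have e2 := type_preserved_iff h0 h1 hd hg (Or.inl hA₀) ((hfam A).1 hA)
      rw [map_mul, mul_smul, map_inv] at e2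
      rw [smul_inv_smul] at e2
      rw [map_mul, mul_smul, map_inv]
      have logic : ∀ a b c d e f : Prop, a → (b ↔ c) → ((a ↔ c) ↔ (d ↔ e)) →
          ((a ↔ b) ↔ (f ↔ e)) → (d ↔ f) := by
        clear * -
        intros
        grind
      exact logic _ _ _ _ _ _ hA₀ hgh e1 e2
    intro A
    have hf := hfam A
    have h2 : IsCentreSet A ↔ IsCentreSet (MulAut.conj (g⁻¹ * h) • A) := by
      by_cases hA : IsCentreSet A ∨ IsAxisSet A
      · exact hc A hA
      · have : ¬ (IsCentreSet (MulAut.conj (g⁻¹ * h) • A) ∨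
            IsAxisSet (MulAut.conj (g⁻¹ * h) • A)) := fun h => hA (hf.2 h)
        exact iff_of_false (fun h => hA (Or.inl h)) (fun h => this (Or.inl h))
    refine ⟨h2, ?_⟩
    rw [hex, hex (MulAut.conj (g⁻¹ * h) • A), hf, h2]

end

end TypePreserving

/-! ### Type-preserving elements are semilinear -/

section Commutant

open Module

variable {F V : Type*} [Field F] [AddCommGroup V] [Module F V]

/-- The linear forms vanishing at `e`. -/
abbrev annihilatorOf (F : Type*) {V : Type*} [Field F] [AddCommGroup V] [Module F V] (e : V) :
    Submodule F (Dual F V) :=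
  LinearMap.ker (Dual.eval F V e)

theorem annihilatorOf_apply {e : V} (φ : annihilatorOf F e) : φ.1 e = 0 := φ.2

theorem finrank_annihilatorOf [FiniteDimensional F V] {e : V} (he : e ≠ 0) :
    finrank F (annihilatorOf F e) + 1 = finrank F V := by
  rw [← Subspace.dual_finrank_eq (K := F) (V := V)]
  exact Module.Dual.finrank_ker_add_one_of_ne_zero (f := Dual.eval F V e)
    (fun h => he ((eval_apply_eq_zero_iff F e).1 h))

/-- A Schur lemma for merely additive T, recovering the field as a commutant. Transvections fixing e
act by φ ↦ φ + φ(w) θ; commuting with them makes each θ an eigenvector, and independent forms share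
their eigenvalue. Independent forms vanishing at e exist because d ≥ 3. -/
theorem exists_smul_eq_of_commute_transvections [FiniteDimensional F V] (hd : 3 ≤ finrank F V)
    {e : V} (he : e ≠ 0) (T : annihilatorOf F e →+ annihilatorOf F e)
    (hT : ∀ (s : V ≃ₗ[F] V) (c : F), LinearEquiv.det s = 1 → s e = c • e →
      ∀ φ ψ : annihilatorOf F e, (∀ x, ψ.1 (s x) = c * φ.1 x) →
        ∀ x, (T ψ).1 (s x) = c * (T φ).1 x) :
    ∃ b : F, ∀ φ, T φ = b • φ := by
  have key : ∀ (φ θ : annihilatorOf F e) (w : V), θ.1 w = 0 →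
      T (φ.1 w • θ) = (T φ).1 w • θ := by
    intro φ θ w hw
    have h1 := hT (LinearEquiv.transvection hw) 1 (LinearEquiv.transvection.det_eq_one hw) (by
      rw [LinearEquiv.transvection.apply, annihilatorOf_apply, zero_smul, add_zero, one_smul])
      (φ + φ.1 w • θ) φ (by
        intro x
        rw [LinearEquiv.transvection.apply]
        simp [mul_comm])
    refine Subtype.ext (LinearMap.ext fun x => ?_)
    have h2 := h1 x
    rw [LinearEquiv.transvection.apply, map_add, map_add, one_mul] at h2
    simp only [Submodule.coe_add, LinearMap.add_apply, map_smul, smul_eq_mul,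
      add_right_inj] at h2
    rw [← h2]
    simp [mul_comm]
  have hpair : ∀ φ θ : annihilatorOf F e, φ.1 ∉ Submodule.span F {θ.1} →
      ∃ w, θ.1 w = 0 ∧ φ.1 w = 1 := by
    intro φ θ hφ
    by_contra! hcon
    refine hφ (dual_mem_span_of_forall fun x hx => ?_)
    by_contra hne
    exact hcon ((φ.1 x)⁻¹ • x) (by simp [hx]) (by simp [hne])
  have htrans : ∀ φ θ : annihilatorOf F e, φ.1 ∉ Submodule.span F {θ.1} →
      ∀ b : F, T φ = b • φ → T θ = b • θ := by
    intro φ θ hφ b hb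
    obtain ⟨w, hw, hw'⟩ := hpair φ θ hφ
    have h1 := key φ θ w hw
    rw [hw', one_smul, hb] at h1
    rw [h1]
    simp [hw']
  have hindep : ∀ θ : annihilatorOf F e, ∃ φ : annihilatorOf F e,
      φ.1 ∉ Submodule.span F {θ.1} := by
    intro θ
    by_contra! hcon
    have hle : annihilatorOf F e ≤ Submodule.span F {θ.1} := fun φ hφ => hcon ⟨φ, hφ⟩
    have h1 := Submodule.finrank_mono hle
    have h2 := finrank_span_le_card (R := F) ({θ.1} : Set (Dual F V))
    have h3 := finrank_annihilatorOf (F := F) he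
    simp at h2
    omega
  obtain ⟨θ₀, hθ₀, b, hb⟩ : ∃ θ₀ : annihilatorOf F e, θ₀ ≠ 0 ∧ ∃ b : F, T θ₀ = b • θ₀ := by
    obtain ⟨θ, hθ⟩ := hindep 0
    obtain ⟨φ, hφ⟩ := hindep θ
    obtain ⟨w, hw, hw'⟩ := hpair φ θ hφ
    have h1 := key φ θ w hw
    rw [hw', one_smul] at h1
    refine ⟨θ, ?_, _, h1⟩
    rintro rfl
    exact hθ (by simp)
  have hsymm : ∀ φ θ : Dual F V, θ ≠ 0 → φ ∉ Submodule.span F {θ} → φ ≠ 0 →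
      θ ∉ Submodule.span F {φ} := by
    intro φ θ hθ h hφ h2
    obtain ⟨a, rfl⟩ := Submodule.mem_span_singleton.1 h2
    have ha : a ≠ 0 := fun ha => hθ (by rw [ha, zero_smul])
    exact h (Submodule.mem_span_singleton.2
      ⟨a⁻¹, by rw [smul_smul, inv_mul_cancel₀ ha, one_smul]⟩)
  refine ⟨b, fun φ => ?_⟩
  by_cases hφ : θ₀.1 ∈ Submodule.span F {φ.1}
  · obtain ⟨ψ, hψ⟩ := hindep φ
    have hφ0 : φ.1 ≠ 0 := by
      intro h
      rw [h] at hφ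
      simp at hφ
      exact hθ₀ hφ
    have hψ0 : ψ.1 ≠ 0 := fun h => hψ (by rw [h]; exact Submodule.zero_mem _)
    refine htrans ψ φ hψ b (htrans θ₀ ψ ?_ b hb)
    intro h
    have h3 := hsymm _ _ hφ0 hψ hψ0
    refine h3 ?_
    obtain ⟨a, ha⟩ := Submodule.mem_span_singleton.1 hφ
    have ha0 : a ≠ 0 := by
      rintro rfl
      rw [zero_smul] at ha
      exact hθ₀ (Subtype.ext ha.symm)
    rw [← ha] at h
    have := Submodule.smul_mem _ a⁻¹ h
    rwa [smul_smul, inv_mul_cancel₀ ha0, one_smul] at this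
  · exact htrans θ₀ φ hφ b hb

/-- An additive endomorphism commuting with the multiplications by squares commutes with all
multiplications, over a finite field. -/
theorem AddMonoidHom.map_smul_of_map_sq_smul [Finite F] {W : Type*} [AddCommGroup W] [Module F W]
    (T : W →+ W) (hT : ∀ (c : F) (w : W), T ((c * c) • w) = (c * c) • T w) (a : F) (w : W) :
    T (a • w) = a • T w := by
  -- In characteristic two every element is a square; otherwise every element is a difference of two
  -- squares.
  by_cases h2 : (2 : F) = 0
  · have hchar : ringChar F = 2 := by
      have := CharP.ringChar_of_prime_eq_zero Nat.prime_two (R := F) (by exact_mod_cast h2)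
      exact this
    obtain ⟨c, rfl⟩ := FiniteField.isSquare_of_char_two hchar a
    exact hT c w
  · have ha : a = ((a + 1) / 2) * ((a + 1) / 2) - ((a - 1) / 2) * ((a - 1) / 2) := by
      field_simp
      ring
    rw [ha, sub_smul, map_sub, hT, hT, ← sub_smul]

/-- A dilation by c along e times one by c⁻¹ along some f with φ f = 1; the determinants cancel. It
serves dimension two, where transvections fixing e act trivially on the forms vanishing at e. -/
theorem exists_diagonal_linearEquiv [FiniteDimensional F V] {e : V} {φ : Dual F V} (he : e ≠ 0)
    (hφ : φ ≠ 0) (h : φ e = 0) {c : F} (hc : c ≠ 0) :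
    ∃ s : V ≃ₗ[F] V, LinearEquiv.det s = 1 ∧ s e = c • e ∧ ∀ x, φ (s x) = c⁻¹ * φ x := by
  obtain ⟨u, hu⟩ := DFunLike.ne_iff.1 hφ
  rw [LinearMap.zero_apply] at hu
  obtain ⟨f, hf⟩ : ∃ f, φ f = 1 := ⟨(φ u)⁻¹ • u, by simp [hu]⟩
  obtain ⟨ψ₀, hψ₀⟩ := exists_dual_apply_ne_zero (F := F) he
  let ψ : Dual F V := (ψ₀ e)⁻¹ • ψ₀
  have hψ : ψ e = 1 := by simp [ψ, hψ₀]
  have h1 : 1 + ψ ((c - 1) • e) = c := by simp [hψ]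
  have h2 : 1 + φ ((c⁻¹ - 1) • f) = c⁻¹ := by simp [hf]
  have hu1 : IsUnit (1 + ψ ((c - 1) • e)) := by
    rw [h1]
    exact hc.isUnit
  have hu2 : IsUnit (1 + φ ((c⁻¹ - 1) • f)) := by
    rw [h2]
    exact (inv_ne_zero hc).isUnit
  refine ⟨LinearEquiv.dilatransvection hu1 * LinearEquiv.dilatransvection hu2, ?_, ?_, fun x => ?_⟩
  · rw [map_mul]
    refine Units.ext ?_
    rw [Units.val_mul, LinearEquiv.coe_det, LinearEquiv.coe_det,
      LinearEquiv.dilatransvection.coe_toLinearMap, LinearEquiv.dilatransvection.coe_toLinearMap,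
      LinearMap.transvection.det, LinearMap.transvection.det, h1, h2, mul_inv_cancel₀ hc,
      Units.val_one]
  · rw [LinearEquiv.mul_apply, LinearEquiv.dilatransvection.apply (h := hu2), h, zero_smul, add_zero,
      LinearEquiv.dilatransvection.apply (h := hu1), hψ, one_smul, sub_smul, one_smul]
    abel
  · rw [LinearEquiv.mul_apply, LinearEquiv.dilatransvection.apply (h := hu1), map_add, map_smul, map_smul,
      h, smul_zero, smul_zero, add_zero, LinearEquiv.dilatransvection.apply (h := hu2), map_add, map_smul,
      map_smul, hf]
    simp only [smul_eq_mul]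
    ring

/-- For d = 2 the forms vanishing at e make up a line, on which the diagonal maps of determinant one
supply the multiplications by squares; these generate the field additively. -/
theorem exists_smul_eq_of_commute [FiniteDimensional F V] [Finite F] (hd : 2 ≤ finrank F V)
    {e : V} (he : e ≠ 0) (T : annihilatorOf F e →+ annihilatorOf F e)
    (hT : ∀ (s : V ≃ₗ[F] V) (c : F), LinearEquiv.det s = 1 → s e = c • e →
      ∀ φ ψ : annihilatorOf F e, (∀ x, ψ.1 (s x) = c * φ.1 x) →
        ∀ x, (T ψ).1 (s x) = c * (T φ).1 x) :
    ∃ b : F, ∀ φ, T φ = b • φ := by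
  rcases (show finrank F V = 2 ∨ 3 ≤ finrank F V by omega) with hd | hd
  swap
  · exact exists_smul_eq_of_commute_transvections hd he T hT
  have h3 := finrank_annihilatorOf (F := F) he
  have h4 : finrank F (annihilatorOf F e) = 1 := by omega
  obtain ⟨φ₀, hφ₀, hspan⟩ : ∃ φ₀ : annihilatorOf F e, φ₀ ≠ 0 ∧ ∀ w, ∃ c : F, c • φ₀ = w := by
    obtain ⟨φ, hφ, hφ0⟩ : ∃ φ ∈ annihilatorOf F e, φ ≠ 0 := by
      refine Submodule.exists_mem_ne_zero_of_ne_bot fun hbot => ?_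
      rw [hbot, finrank_bot] at h4
      omega
    refine ⟨⟨φ, hφ⟩, fun h => hφ0 (congrArg Subtype.val h), fun w => ?_⟩
    have hle : Submodule.span F {φ} = annihilatorOf F e :=
      Submodule.eq_of_le_of_finrank_eq ((Submodule.span_singleton_le_iff_mem _ _).2 hφ)
        (by rw [finrank_span_singleton hφ0, h4])
    obtain ⟨c, hc⟩ := Submodule.mem_span_singleton.1 (hle.ge w.2)
    exact ⟨c, Subtype.ext hc⟩
  have hφ₀' : φ₀.1 ≠ 0 := fun h => hφ₀ (Subtype.ext h)
  have hsq : ∀ (c : F) (φ : annihilatorOf F e), T ((c * c) • φ) = (c * c) • T φ := by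
    intro c φ
    by_cases hc : c = 0
    · simp [hc]
    obtain ⟨s, hs1, hs2, hs3⟩ := exists_diagonal_linearEquiv he hφ₀' φ₀.2 hc
    have hs4 : ∀ (ψ : annihilatorOf F e) x, ψ.1 (s x) = c⁻¹ * ψ.1 x := by
      intro ψ x
      obtain ⟨a, rfl⟩ := hspan ψ
      simp only [Submodule.coe_smul, LinearMap.smul_apply, smul_eq_mul, hs3]
      ring
    have h4 := hT s c hs1 hs2 φ ((c * c) • φ) (fun x => by
      rw [hs4]
      simp only [Submodule.coe_smul, LinearMap.smul_apply, smul_eq_mul]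
      field_simp)
    refine Subtype.ext (LinearMap.ext fun y => ?_)
    obtain ⟨x, rfl⟩ := s.surjective y
    rw [h4]
    simp only [Submodule.coe_smul, LinearMap.smul_apply, smul_eq_mul, hs4]
    field_simp
  obtain ⟨b, hb⟩ := hspan (T φ₀)
  refine ⟨b, fun φ => ?_⟩
  obtain ⟨a, rfl⟩ := hspan φ
  rw [T.map_smul_of_map_sq_smul hsq, ← hb, smul_comm]

end Commutant

/-! ### The field endomorphism attached to a type-preserving permutation -/

section Semilinear

open Module
open scoped Pointwise

variable {F V : Type*} [Field F] [AddCommGroup V] [Module F V] [FiniteDimensional F V] {m : ℕ}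
variable (h0 : 0 < m) (h1 : m < finrank F V)
include h0 h1

theorem transvPerm_left_injective {e : V} (he : e ≠ 0) {φ ψ : annihilatorOf F e}
    (h : transvPerm m φ.1 e = transvPerm m ψ.1 e) : φ = ψ := by
  refine Subtype.ext (LinearMap.ext fun x => ?_)
  exact smul_left_injective F he ((transvPerm_eq_iff h0 h1 φ.2 ψ.2).1 h x)

/-- Translates the hypothesis of `exists_smul_eq_of_commute` into conjugation of transvections with
centre e. -/
theorem permHom_conj_transvPerm_eq_iff {e : V} (he : e ≠ 0) {s : V ≃ₗ[F] V} {c : F}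
    (hs : s e = c • e) (φ ψ : annihilatorOf F e) :
    permHom m s * transvPerm m φ.1 e * (permHom m s)⁻¹ = transvPerm m ψ.1 e ↔
      ∀ x, ψ.1 (s x) = c * φ.1 x := by
  rw [permHom_conj_transvPerm s (annihilatorOf_apply φ), hs, ← transvPerm_smul_left,
    transvPerm_eq_iff h0 h1 _ (annihilatorOf_apply ψ)]
  · constructor
    · intro h x
      have := smul_left_injective F he (h (s x))
      simpa using this.symm
    · intro h x
      have := h (s.symm x)
      rw [LinearEquiv.apply_symm_apply] at this
      rw [this]
      rfl
  · have h2 := annihilatorOf_apply φ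
    have h3 : e = c • s.symm e := by
      rw [← map_smul, ← hs, LinearEquiv.symm_apply_apply]
    have hc : c ≠ 0 := by
      rintro rfl
      rw [zero_smul] at h3
      exact he h3
    have h4 : φ.1 (s.symm e) = 0 := by
      have := congrArg φ.1 h3
      rw [h2, map_smul, eq_comm, smul_eq_zero] at this
      exact this.resolve_left hc
    simp [h4]

/-- An element of the symmetric group preserving the transvections with centre `e` acts additively
on them. -/
theorem exists_addEquiv_of_conj_centreSet {e : V} (he : e ≠ 0)
    {k : Equiv.Perm (SubspacesOfDim F V m)}
    (hk : MulAut.conj k • centreSet (F := F) m e = centreSet m e) :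
    ∃ γ : annihilatorOf F e ≃+ annihilatorOf F e,
      ∀ φ, k * transvPerm m φ.1 e * k⁻¹ = transvPerm m (γ φ).1 e := by
  have key : ∀ k : Equiv.Perm (SubspacesOfDim F V m),
      MulAut.conj k • centreSet (F := F) m e = centreSet m e → ∀ φ : annihilatorOf F e,
      ∃ ψ : annihilatorOf F e, k * transvPerm m φ.1 e * k⁻¹ = transvPerm m ψ.1 e := by
    intro k hk φ
    by_cases hφ : φ.1 = 0
    · exact ⟨0, by rw [hφ, transvPerm_zero_left, mul_one, mul_inv_cancel]; simp [transvPerm_zero_left]⟩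
    · have hmem : MulAut.conj k • transvPerm m φ.1 e ∈ centreSet (F := F) m e := by
        rw [← hk]
        exact Set.smul_mem_smul_set ⟨φ.1, hφ, φ.2, rfl⟩
      obtain ⟨ψ, -, h2, h3⟩ := hmem
      exact ⟨⟨ψ, h2⟩, h3⟩
  have hk' : MulAut.conj k⁻¹ • centreSet (F := F) m e = centreSet m e := by
    rw [map_inv, inv_smul_eq_iff, hk]
  choose γ hγ using key k hk
  choose γ' hγ' using key k⁻¹ hk'
  refine ⟨{ toFun := γ, invFun := γ', left_inv := fun φ => ?_, right_inv := fun φ => ?_,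
            map_add' := fun φ ψ => ?_ }, hγ⟩
  · apply transvPerm_left_injective h0 h1 he
    rw [← hγ', ← hγ]
    group
  · apply transvPerm_left_injective h0 h1 he
    rw [← hγ, ← hγ']
    group
  · apply transvPerm_left_injective h0 h1 he
    rw [← hγ, Submodule.coe_add, Submodule.coe_add, 
      ← transvPerm_mul_left (annihilatorOf_apply φ) (annihilatorOf_apply ψ),
      ← transvPerm_mul_left (annihilatorOf_apply (γ φ)) (annihilatorOf_apply (γ ψ)), ← hγ, ← hγ]
    group

/-- Conjugation by k normalises the action of the stabiliser of the line of e in SL(V) on the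
transvections with centre e, hence its commutant, which is F; σ is the induced map on F. -/
theorem exists_ringHom_of_conj_centreSet [Finite F] {e : V} (he : e ≠ 0)
    {k : Equiv.Perm (SubspacesOfDim F V m)}
    (hkN : k ∈ Subgroup.normalizer (slImage F V m : Set (Equiv.Perm (SubspacesOfDim F V m))))
    (hk : MulAut.conj k • centreSet (F := F) m e = centreSet m e) :
    ∃ (γ : annihilatorOf F e ≃+ annihilatorOf F e) (σ : F →+* F),
      (∀ φ, k * transvPerm m φ.1 e * k⁻¹ = transvPerm m (γ φ).1 e) ∧
      ∀ (a : F) φ, γ (a • φ) = σ a • γ φ := by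
  obtain ⟨γ, hγ⟩ := exists_addEquiv_of_conj_centreSet h0 h1 he hk
  have hd : 2 ≤ finrank F V := by omega
  -- The conjugate k⁻¹ s k comes from SL(V) and keeps the centre set of e, so its lift has e as an
  -- eigenvector.
  have hlift : ∀ (s : V ≃ₗ[F] V) (c : F), LinearEquiv.det s = 1 → s e = c • e →
      ∃ (s' : V ≃ₗ[F] V) (c' : F), s' e = c' • e ∧ permHom m s * k = k * permHom m s' := by
    intro s c hs hse
    have h2 : k⁻¹ * permHom m s * k⁻¹⁻¹ ∈ slImage F V m :=
      (Subgroup.mem_normalizer_iff.1 (inv_mem hkN) _).1 (mem_slImage_iff.2 ⟨s, hs, rfl⟩)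
    obtain ⟨s', -, hs'⟩ := mem_slImage_iff.1 h2
    have h3 : permHom m s * k = k * permHom m s' := by
      rw [hs']
      group
    have hc : c ≠ 0 := by
      rintro rfl
      rw [zero_smul, LinearEquiv.map_eq_zero_iff] at hse
      exact he hse
    have h4 : centreSet (F := F) m (s' e) = centreSet m e := by
      rw [← conj_centreSet, hs', map_mul, map_mul, mul_smul, mul_smul, inv_inv, hk, conj_centreSet,
        hse, centreSet_smul hc, map_inv, inv_smul_eq_iff, hk]
    obtain ⟨φ, hφ, hφ'⟩ := exists_dual_ne_zero_eq_zero (F := F) hd (s' e)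
    have hmem : transvPerm m φ (s' e) ∈ centreSet (F := F) m e := by
      rw [← h4]
      exact ⟨φ, hφ, hφ', rfl⟩
    obtain ⟨c', -, hc'⟩ :=
      (transvPerm_mem_centreSet_iff h0 h1 hφ (by simpa using he) hφ').1 hmem
    exact ⟨s', c', hc', h3⟩
  have hscal : ∀ a : F, ∃ b : F, ∀ φ, γ (a • γ.symm φ) = b • φ := by
    intro a
    let T : annihilatorOf F e →+ annihilatorOf F e :=
      { toFun := fun φ => γ (a • γ.symm φ)
        map_zero' := by simp
        map_add' := fun φ ψ => by simp }
    refine exists_smul_eq_of_commute hd he T fun s c hs hse φ ψ hφψ => ?_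
    obtain ⟨s', c', hs', hcomm⟩ := hlift s c hs hse
    obtain ⟨α, rfl⟩ := γ.surjective φ
    obtain ⟨β, rfl⟩ := γ.surjective ψ
    have hT : ∀ φ, T (γ φ) = γ (a • φ) := fun φ => by simp [T]
    have hmove : ∀ φ ψ : annihilatorOf F e, (∀ x, (γ ψ).1 (s x) = c * (γ φ).1 x) ↔
        ∀ x, ψ.1 (s' x) = c' * φ.1 x := by
      intro φ ψ
      rw [← permHom_conj_transvPerm_eq_iff h0 h1 he hse,
        ← permHom_conj_transvPerm_eq_iff h0 h1 he hs', ← hγ, ← hγ]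
      have e1 : permHom m s * (k * transvPerm m φ.1 e * k⁻¹) * (permHom m s)⁻¹ =
          k * (permHom m s' * transvPerm m φ.1 e * (permHom m s')⁻¹) * k⁻¹ := by
        have : permHom m s = k * permHom m s' * k⁻¹ := by
          rw [← hcomm]
          group
        rw [this]
        group
      rw [e1, mul_left_inj, mul_right_inj]
    rw [hT, hT, hmove]
    intro x
    have := (hmove α β).1 hφψ x
    simp only [Submodule.coe_smul, LinearMap.smul_apply, this, smul_eq_mul]
    ring
  choose σ hσ using hscal
  have hne : Nontrivial (annihilatorOf F e) := by
    obtain ⟨φ, hφ, hφ'⟩ := exists_dual_ne_zero_eq_zero (F := F) hd e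
    exact ⟨⟨φ, hφ'⟩, 0, fun h => hφ (congrArg Subtype.val h)⟩
  obtain ⟨φ₀, hφ₀⟩ := exists_ne (0 : annihilatorOf F e)
  have hinj : ∀ {a b : F}, a • φ₀ = b • φ₀ → a = b := by
    intro a b hab
    exact smul_left_injective F (fun h => hφ₀ (Subtype.ext h) : φ₀.1 ≠ 0) (congrArg Subtype.val hab)
  refine ⟨γ, { toFun := σ, map_one' := ?_, map_mul' := ?_, map_zero' := ?_, map_add' := ?_ },
    hγ, fun a φ => ?_⟩
  · refine hinj ?_
    rw [← hσ]
    simp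
  · intro a b
    refine hinj ?_
    rw [← hσ, mul_smul, mul_smul, ← hσ b, ← hσ a]
    simp
  · refine hinj ?_
    rw [← hσ]
    simp
  · intro a b
    refine hinj ?_
    rw [← hσ, add_smul, add_smul, map_add, hσ, hσ]
  · have := hσ a (γ φ)
    rwa [AddEquiv.symm_apply_apply] at this

/-- A type-preserving permutation commuting with all transvections of a fixed centre is linear. -/
theorem mem_range_permHom_of_commute {e : V} (he : e ≠ 0)
    {c : Equiv.Perm (SubspacesOfDim F V m)} (hc : c ∈ typeSubgroup F V m)
    (hcomm : ∀ φ : annihilatorOf F e, c * transvPerm m φ.1 e * c⁻¹ = transvPerm m φ.1 e) :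
    c ∈ (permHom (F := F) (V := V) m).range := by
  have haxis : ∀ {φ : Dual F V}, φ ≠ 0 → φ e = 0 → ∀ {ψ : Dual F V}, transvPerm m φ e ∈
      axisSet m ψ → axisSet m ψ = axisSet m φ := by
    intro φ hφ h ψ hmem
    exact (axisSet_eq_of_mem h0 h1 hφ ⟨e, he, h, rfl⟩ hmem).symm
  -- Hyperplanes avoiding e, normalised by φ e = 1, are permuted transitively by the transvections
  -- with centre e.
  have htrans : ∀ {φ ψ : Dual F V}, φ e = 1 → ψ e = 1 →
      MulAut.conj (transvPerm m (φ - ψ) e) • axisSet m φ = axisSet m ψ := by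
    intro φ ψ hφ hψ
    have h2 : (φ - ψ) e = 0 := by simp [hφ, hψ]
    rw [transvPerm_eq h2, conj_axisSet, LinearEquiv.transvection.symm_eq h2 (by rw [map_neg, h2, neg_zero])]
    congr 1
    refine LinearMap.ext fun x => ?_
    change φ (x + (φ - ψ) x • -e) = ψ x
    simp [hφ]
  have hscale : ∀ {φ : Dual F V}, φ e ≠ 0 → ∃ ψ : Dual F V, ψ e = 1 ∧ axisSet m ψ = axisSet m φ :=
    fun {φ} h => ⟨(φ e)⁻¹ • φ, by simp [h], axisSet_smul (inv_ne_zero h) φ⟩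
  obtain ⟨φ₀, hφ₀⟩ : ∃ φ₀ : Dual F V, φ₀ e = 1 := by
    obtain ⟨φ, hφ⟩ := exists_dual_apply_ne_zero (F := F) he
    exact ⟨(φ e)⁻¹ • φ, by simp [hφ]⟩
  have hφ₀' : φ₀ ≠ 0 := by
    rintro rfl
    simp at hφ₀
  obtain ⟨φ₁, hφ₁, hconj⟩ : ∃ φ₁ : Dual F V, φ₁ e = 1 ∧
      MulAut.conj c • axisSet m φ₀ = axisSet m φ₁ := by
    obtain ⟨φ', hφ', h2⟩ := (hc.2 _).2.1 ⟨φ₀, hφ₀', rfl⟩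
    have h3 : φ' e ≠ 0 := by
      intro h3
      have hmem : transvPerm m φ' e ∈ MulAut.conj c • axisSet m φ₀ := by
        rw [h2]
        exact ⟨e, he, h3, rfl⟩
      rw [← hcomm ⟨φ', h3⟩] at hmem
      have hmem' : transvPerm m φ' e ∈ axisSet m φ₀ :=
        (Set.smul_mem_smul_set_iff (a := MulAut.conj c)).1 hmem
      obtain ⟨a, ha, rfl⟩ := (transvPerm_mem_axisSet_iff h0 h1 hφ' he h3).1 hmem'
      simp [hφ₀, ha] at h3
    obtain ⟨φ₁, h4, h5⟩ := hscale h3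
    exact ⟨φ₁, h4, h2.trans h5.symm⟩
  have hdiff : (φ₁ - φ₀) e = 0 := by simp [hφ₀, hφ₁]
  have hu : transvPerm m (φ₁ - φ₀) e ∈ (permHom (F := F) (V := V) m).range :=
    ⟨_, (transvPerm_eq hdiff).symm⟩
  -- The correction makes c' fix the hyperplane of φ₀. Since c' still commutes with the
  -- transvections with centre e, it fixes every hyperplane avoiding e; those through e are the axes
  -- of these transvections.
  let c' := transvPerm m (φ₁ - φ₀) e * c
  have hc' : c' ∈ typeSubgroup F V m := mul_mem (range_permHom_le_typeSubgroup hu) hc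
  have hcomm' : ∀ φ : annihilatorOf F e, c' * transvPerm m φ.1 e = transvPerm m φ.1 e * c' := by
    intro φ
    have h2 := mul_inv_eq_iff_eq_mul.1 (hcomm φ)
    simp only [c']
    rw [mul_assoc, h2, ← mul_assoc, ← mul_assoc, transvPerm_mul_left hdiff (annihilatorOf_apply φ),
      transvPerm_mul_left (annihilatorOf_apply φ) hdiff, add_comm]
  have hfix₀ : MulAut.conj c' • axisSet m φ₀ = axisSet m φ₀ := by
    rw [map_mul, mul_smul, hconj, htrans hφ₁ hφ₀]
  have hfix₁ : ∀ φ : Dual F V, φ e = 1 → MulAut.conj c' • axisSet m φ = axisSet m φ := by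
    intro φ hφ
    have h2 : (φ₀ - φ) e = 0 := by simp [hφ₀, hφ]
    rw [← htrans hφ₀ hφ, ← mul_smul, ← map_mul, hcomm' ⟨φ₀ - φ, h2⟩, map_mul, mul_smul, hfix₀]
  have hfix : ∀ φ : Dual F V, φ ≠ 0 → MulAut.conj c' • axisSet m φ = axisSet m φ := by
    intro φ hφ
    by_cases h : φ e = 0
    · obtain ⟨ψ, -, h2⟩ := (hc'.2 _).2.1 ⟨φ, hφ, rfl⟩
      rw [h2]
      refine haxis hφ h ?_
      rw [← h2]
      have h3 : transvPerm m φ e = MulAut.conj c' • transvPerm m φ e :=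
        (mul_inv_eq_iff_eq_mul.2 (hcomm' ⟨φ, h⟩)).symm
      rw [h3]
      exact Set.smul_mem_smul_set ⟨e, he, h, rfl⟩
    · obtain ⟨ψ, h2, h3⟩ := hscale h
      rw [← h3]
      exact hfix₁ ψ h2
  -- If s' lifts the conjugate of s by c', then s⁻¹ s' fixes every hyperplane and is scalar; so c'
  -- centralises the image of SL(V).
  have hone : c' = 1 := by
    refine eq_one_of_commute_slImage fun p hp => ?_
    obtain ⟨s, hs, rfl⟩ := mem_slImage_iff.1 hp
    obtain ⟨s', -, hs'⟩ := mem_slImage_iff.1 ((Subgroup.mem_normalizer_iff.1 hc'.1 _).1 hp)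
    have h2 : ∀ φ : Dual F V, φ ≠ 0 →
        MulAut.conj (permHom m (s⁻¹ * s')) • axisSet m φ = axisSet m φ := by
      intro φ hφ
      have hφs : φ ∘ₗ (s.symm : V →ₗ[F] V) ≠ 0 := fun h3 => hφ (LinearMap.ext fun x => by
        simpa using congrArg (fun f : Dual F V => f (s x)) h3)
      have h4 : MulAut.conj c'⁻¹ • axisSet m φ = axisSet m φ := by
        rw [map_inv, inv_smul_eq_iff, hfix φ hφ]
      rw [map_mul, map_mul, mul_smul, hs', map_mul, map_mul, mul_smul, mul_smul, h4,
        conj_axisSet, hfix _ hφs, ← conj_axisSet, map_inv, map_inv, inv_smul_smul]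
    have h3 : permHom m (s⁻¹ * s') = 1 := by
      rw [← inv_eq_one, ← map_inv]
      refine (permHom_eq_one_iff h0 h1 _).2 ?_
      refine exists_eq_smul_of_forall_mem_span ((s⁻¹ * s')⁻¹ : V ≃ₗ[F] V).toLinearMap fun v => ?_
      refine mem_span_of_forall_dual fun φ hφv => ?_
      by_cases hφ : φ = 0
      · rw [hφ]; rfl
      have h4 := h2 φ hφ
      rw [conj_axisSet] at h4
      obtain ⟨w, hw, hφw⟩ := exists_ne_zero_apply_eq_zero (show 2 ≤ finrank F V by omega) φ
      have hmem : transvPerm m φ w ∈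
          axisSet m (φ ∘ₗ ((s⁻¹ * s').symm : V →ₗ[F] V)) := by
        rw [h4]
        exact ⟨w, hw, hφw, rfl⟩
      obtain ⟨a, ha, h5⟩ := (transvPerm_mem_axisSet_iff h0 h1 hφ hw hφw).1 hmem
      have h6 := congrArg (fun f : Dual F V => f v) h5
      simp only [hφv, LinearMap.smul_apply, smul_eq_mul] at h6
      exact (mul_eq_zero.1 h6.symm).resolve_left ha
    rw [map_mul, map_inv, inv_mul_eq_one] at h3
    rw [← h3] at hs'
    exact (mul_inv_eq_iff_eq_mul.1 hs'.symm)
  have : c = (transvPerm m (φ₁ - φ₀) e)⁻¹ := eq_inv_of_mul_eq_one_right hone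
  rw [this]
  exact inv_mem hu

/-- Extended by φ₀ ↦ φ₀, the map γ becomes a linear automorphism δ of the dual. The map l with
transpose δ fixes e and undoes γ, so `mem_range_permHom_of_commute` applies to `permHom m l * k`. -/
theorem mem_range_permHom_of_linear {e : V} (he : e ≠ 0)
    {k : Equiv.Perm (SubspacesOfDim F V m)} (hk : k ∈ typeSubgroup F V m)
    (γ : annihilatorOf F e ≃+ annihilatorOf F e)
    (hγ : ∀ φ, k * transvPerm m φ.1 e * k⁻¹ = transvPerm m (γ φ).1 e)
    (hlin : ∀ (a : F) φ, γ (a • φ) = a • γ φ) :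
    k ∈ (permHom (F := F) (V := V) m).range := by
  obtain ⟨φ₀, hφ₀⟩ : ∃ φ₀ : Dual F V, φ₀ e = 1 := by
    obtain ⟨φ, hφ⟩ := exists_dual_apply_ne_zero (F := F) he
    exact ⟨(φ e)⁻¹ • φ, by simp [hφ]⟩
  let π : Dual F V →ₗ[F] annihilatorOf F e :=
    { toFun := fun ψ => ⟨ψ - ψ e • φ₀, by simp [hφ₀]⟩
      map_add' := fun ψ θ => Subtype.ext (by
        change (ψ + θ) - (ψ e + θ e) • φ₀ = (ψ - ψ e • φ₀) + (θ - θ e • φ₀)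
        rw [add_smul]
        abel)
      map_smul' := fun a ψ => Subtype.ext (by simp [smul_sub, smul_smul]) }
  let γl : annihilatorOf F e →ₗ[F] annihilatorOf F e :=
    { toFun := γ, map_add' := γ.map_add, map_smul' := hlin }
  let δ : Dual F V →ₗ[F] Dual F V :=
    (annihilatorOf F e).subtype ∘ₗ γl ∘ₗ π + (Dual.eval F V e).smulRight φ₀
  have hδ : ∀ ψ, δ ψ = (γ (π ψ)).1 + ψ e • φ₀ := fun ψ => rfl
  have hδe : ∀ ψ, δ ψ e = ψ e := fun ψ => by
    rw [hδ, LinearMap.add_apply, annihilatorOf_apply]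
    simp [hφ₀]
  have hπ : ∀ φ : annihilatorOf F e, π φ.1 = φ := fun φ => Subtype.ext (by
    change φ.1 - φ.1 e • φ₀ = φ.1
    rw [annihilatorOf_apply, zero_smul, sub_zero])
  have hδφ : ∀ φ : annihilatorOf F e, δ φ.1 = (γ φ).1 := fun φ => by
    rw [hδ, hπ, annihilatorOf_apply, zero_smul, add_zero]
  have hδinj : Function.Injective δ := by
    rw [injective_iff_map_eq_zero]
    intro ψ hψ
    have h2 : ψ e = 0 := by rw [← hδe, hψ]; rfl
    have h3 := hδφ ⟨ψ, h2⟩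
    rw [hψ] at h3
    have h4 : γ ⟨ψ, h2⟩ = 0 := Subtype.ext h3.symm
    exact congrArg Subtype.val ((AddEquiv.map_eq_zero_iff γ).1 h4)
  have hδsurj : Function.Surjective δ := LinearMap.surjective_of_injective hδinj
  let l₀ : V →ₗ[F] V := (evalEquiv F V).symm.toLinearMap ∘ₗ δ.dualMap ∘ₗ (evalEquiv F V).toLinearMap
  have hl₀ : ∀ (ψ : Dual F V) x, ψ (l₀ x) = δ ψ x := by
    intro ψ x
    change ψ ((evalEquiv F V).symm (δ.dualMap (evalEquiv F V x))) = _
    rw [apply_evalEquiv_symm_apply]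
    rfl
  have hl₀inj : Function.Injective l₀ := by
    rw [injective_iff_map_eq_zero]
    intro x hx
    refine (forall_dual_apply_eq_zero_iff F x).1 fun ψ => ?_
    obtain ⟨θ, rfl⟩ := hδsurj ψ
    rw [← hl₀, hx, map_zero]
  let l : V ≃ₗ[F] V := LinearEquiv.ofInjectiveEndo l₀ hl₀inj
  have hl : ∀ (ψ : Dual F V) x, ψ (l x) = δ ψ x := hl₀
  have hle : l e = e := by
    rw [← sub_eq_zero]
    refine (forall_dual_apply_eq_zero_iff F _).1 fun ψ => ?_
    rw [map_sub, hl, hδe, sub_self]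
  have hcommute : permHom m l * k ∈ (permHom (F := F) (V := V) m).range := by
    refine mem_range_permHom_of_commute h0 h1 he
      (mul_mem (range_permHom_le_typeSubgroup ⟨l, rfl⟩) hk) fun φ => ?_
    have h2 := (permHom_conj_transvPerm_eq_iff h0 h1 he (c := 1)
      (by rw [hle, one_smul]) (γ φ) φ).2 fun x => by rw [hl, hδφ, one_mul]
    rw [← hγ φ] at h2
    refine Eq.trans ?_ h2
    group
  have hl_mem : permHom m l ∈ (permHom (F := F) (V := V) m).range := ⟨l, rfl⟩
  exact (Subgroup.mul_mem_cancel_left _ hl_mem).1 hcommute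

/-- After a linear correction each g fixes the point of e and acquires a σ. Two elements with the
same σ differ, up to linear maps, by one acting linearly on the transvections with centre e. -/
theorem relIndex_range_permHom_le [Finite F] :
    (permHom (F := F) (V := V) m).range.relIndex (typeSubgroup F V m) ≤ Nat.card (F →+* F) := by
  have hV : Nontrivial V := Module.nontrivial_of_finrank_pos (R := F) (by omega)
  have hfin : Finite (F →+* F) := Finite.of_injective (fun f : F →+* F => (f : F → F))
    DFunLike.coe_injective
  obtain ⟨e, he⟩ := exists_ne (0 : V)
  have key : ∀ g ∈ typeSubgroup F V m, ∃ (l : V ≃ₗ[F] V) (σ : F →+* F),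
      MulAut.conj (g * permHom m l) • centreSet (F := F) m e = centreSet m e ∧
      ∃ γ : annihilatorOf F e ≃+ annihilatorOf F e,
        (∀ φ, (g * permHom m l) * transvPerm m φ.1 e * (g * permHom m l)⁻¹ =
          transvPerm m (γ φ).1 e) ∧ ∀ (a : F) φ, γ (a • φ) = σ a • γ φ := by
    intro g hg
    obtain ⟨w, hw, h2⟩ := ((inv_mem hg).2 _).1.1 (⟨e, he, rfl⟩ : IsCentreSet (centreSet m e))
    obtain ⟨l, hl⟩ := exists_linearEquiv_apply_eq (F := F) he hw
    have h3 : MulAut.conj (g * permHom m l) • centreSet (F := F) m e = centreSet m e := by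
      rw [map_mul, mul_smul, conj_centreSet, hl, ← h2, map_inv, smul_inv_smul]
    obtain ⟨γ, σ, h4, h5⟩ := exists_ringHom_of_conj_centreSet h0 h1 he
      (mul_mem (typeSubgroup_le_normalizer hg) (permHom_mem_normalizer l)) h3
    exact ⟨l, σ, h3, γ, h4, h5⟩
  choose! l σ hl hγ using key
  refine Subgroup.relIndex_le_card σ fun g hg h hh hgh => ?_
  obtain ⟨γ, hγ1, hγ2⟩ := hγ g hg
  obtain ⟨δ, hδ1, hδ2⟩ := hγ h hh
  have hmem : (g * permHom m (l g))⁻¹ * (h * permHom m (l h)) ∈ typeSubgroup F V m :=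
    mul_mem (inv_mem (mul_mem hg (range_permHom_le_typeSubgroup ⟨_, rfl⟩)))
      (mul_mem hh (range_permHom_le_typeSubgroup ⟨_, rfl⟩))
  have h2 := mem_range_permHom_of_linear h0 h1 he hmem (δ.trans γ.symm) (fun φ => by
    have h3 := hγ1 (γ.symm (δ φ))
    rw [AddEquiv.apply_symm_apply, ← hδ1] at h3
    rw [AddEquiv.trans_apply]
    calc _ = (g * permHom m (l g))⁻¹ * (h * permHom m (l h) * transvPerm m φ.1 e *
          (h * permHom m (l h))⁻¹) * (g * permHom m (l g)) := by group
      _ = _ := by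
        rw [← h3]
        group) (fun a φ => by
    rw [AddEquiv.trans_apply, AddEquiv.trans_apply, AddEquiv.symm_apply_eq, hγ2,
      AddEquiv.apply_symm_apply, hδ2, hgh])
  have h3 : g⁻¹ * h = permHom m (l g) * ((g * permHom m (l g))⁻¹ * (h * permHom m (l h))) *
      (permHom m (l h))⁻¹ := by group
  rw [h3]
  exact mul_mem (mul_mem ⟨_, rfl⟩ h2) (inv_mem ⟨_, rfl⟩)

/-- The projective general linear group has index at most `2 |Aut F|` in the normaliser of the
projective special linear group in the symmetric group on the `m`-subspaces. -/
theorem relIndex_range_permHom_normalizer_le [Finite F] :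
    (permHom (F := F) (V := V) m).range.relIndex
      (Subgroup.normalizer (slImage F V m : Set (Equiv.Perm (SubspacesOfDim F V m)))) ≤
      2 * Nat.card (F →+* F) := by
  rw [← Subgroup.relIndex_mul_relIndex _ _ _ range_permHom_le_typeSubgroup
    typeSubgroup_le_normalizer, mul_comm]
  exact Nat.mul_le_mul (relIndex_typeSubgroup_le_two h0 h1) (relIndex_range_permHom_le h0 h1)

end Semilinear

/-! ### Chains of stabilisers in a general linear group -/

section StabilizerAlgebra

open Module

variable {F E : Type*} [Field F] [AddCommGroup E] [Module F E] [FiniteDimensional F E]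

/-- The endomorphisms preserving a subspace. -/
def preserving (W : Submodule F E) : Submodule F (End F E) where
  carrier := {N | ∀ x ∈ W, N x ∈ W}
  add_mem' := fun ha hb x hx => W.add_mem (ha x hx) (hb x hx)
  zero_mem' := fun _ _ => W.zero_mem
  smul_mem' := fun c _ ha x hx => W.smul_mem c (ha x hx)

omit [FiniteDimensional F E] in
theorem mem_preserving {W : Submodule F E} {N : End F E} :
    N ∈ preserving W ↔ ∀ x ∈ W, N x ∈ W := Iff.rfl

/-- If a space `A` of endomorphisms contains all those vanishing on `S`, then requiring that `W` be
preserved cuts down the dimension of `A` by at least `codim W` times the growth of `S ⊔ W`. -/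
theorem finrank_inf_preserving_add_le (A : Submodule F (End F E)) (S W : Submodule F E)
    (hA : ∀ N : End F E, S ≤ LinearMap.ker N → N ∈ A) :
    finrank F ↥(A ⊓ preserving W) +
      (finrank F ↥(S ⊔ W) - finrank F S) * (finrank F E - finrank F W) ≤ finrank F A := by
  -- With C a complement of S ⊓ W in W, dim C is the growth of S ⊔ W. Maps C → E ⧸ W lift to
  -- endomorphisms killing S, which lie in A, so restriction R is onto, while it kills `A ⊓
  -- preserving W`.
  obtain ⟨C', hC'⟩ := Submodule.exists_isCompl ((S ⊓ W).comap W.subtype)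
  let C : Submodule F E := C'.map W.subtype
  have hCW : C ≤ W := Submodule.map_subtype_le W C'
  have hdisj : Disjoint S C := by
    rw [Submodule.disjoint_def]
    rintro _ hxS ⟨x, hx, rfl⟩
    have : x ∈ (S ⊓ W).comap W.subtype := ⟨hxS, x.2⟩
    rw [Submodule.disjoint_def.1 hC'.disjoint x this hx]
    rfl
  have hsup : S ⊔ W = S ⊔ C := by
    refine le_antisymm (sup_le le_sup_left fun x hx => ?_) (sup_le_sup_left hCW S)
    have htop : (⟨x, hx⟩ : W) ∈ (S ⊓ W).comap W.subtype ⊔ C' := by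
      rw [hC'.sup_eq_top]
      trivial
    obtain ⟨y, hy, z, hz, hyz⟩ := Submodule.mem_sup.1 htop
    have : x = y + z := (congrArg Subtype.val hyz).symm
    rw [this]
    exact Submodule.add_mem_sup hy.1 ⟨z, hz, rfl⟩
  have hdim : finrank F ↥(S ⊔ W) = finrank F S + finrank F C := by
    have := Submodule.finrank_sup_add_finrank_inf_eq S C
    rw [hdisj.eq_bot, finrank_bot] at this
    rw [hsup]
    omega
  let R : A →ₗ[F] (C →ₗ[F] E ⧸ W) :=
    { toFun := fun N => W.mkQ ∘ₗ N.1 ∘ₗ C.subtype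
      map_add' := fun N M => by ext x; simp
      map_smul' := fun c N => by ext x; simp }
  have hR : ∀ N x, R N x = W.mkQ (N.1 x) := fun N x => rfl
  have hsurj : Function.Surjective R := by
    intro f
    obtain ⟨g, hg⟩ := Module.projective_lifting_property W.mkQ f W.mkQ_surjective
    obtain ⟨D, hSD, hD⟩ := hdisj.exists_isCompl
    let N : End F E := g ∘ₗ Submodule.projectionOnto C D hD.symm
    refine ⟨⟨N, hA N fun x hx => ?_⟩, LinearMap.ext fun x => ?_⟩
    · change g (Submodule.projectionOnto C D hD.symm x) = 0
      rw [(Submodule.projectionOnto_apply_eq_zero_iff hD.symm).2 (hSD hx), map_zero]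
    · rw [hR]
      change W.mkQ (g (Submodule.projectionOnto C D hD.symm x)) = _
      rw [Submodule.projectionOnto_apply_left, ← hg]
      rfl
  have hrk := LinearMap.finrank_range_add_finrank_ker R
  rw [LinearMap.range_eq_top.2 hsurj, finrank_top, Module.finrank_linearMap,
    Submodule.finrank_quotient] at hrk
  have hker : finrank F ↥(A ⊓ preserving W) ≤ finrank F (LinearMap.ker R) := by
    rw [(Submodule.equivMapOfInjective A.subtype Subtype.val_injective
      (LinearMap.ker R)).finrank_eq]
    refine Submodule.finrank_mono ?_
    rintro N ⟨hNA, hNW⟩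
    refine ⟨⟨N, hNA⟩, LinearMap.ext fun x => ?_, rfl⟩
    rw [hR, Submodule.mkQ_apply, LinearMap.zero_apply, Submodule.Quotient.mk_eq_zero]
    exact hNW x (hCW x.2)
  rw [hdim, Nat.add_sub_cancel_left, ← hrk]
  omega

/-- A contains a copy of Hom(E/S, E), of dimension at least (k + 1)(dim E - dim S). The extra 1
comes from dim E - dim S if S ≠ E, and from the identity if S = E. -/
theorem finrank_endomorphisms_lower_bound (A : Submodule F (End F E)) (S : Submodule F E)
    (hA : ∀ N : End F E, S ≤ LinearMap.ker N → N ∈ A) (h1 : (1 : End F E) ∈ A)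
    (hE : 0 < finrank F E) {k : ℕ} (hk : k < finrank F E) :
    k * finrank F E + 1 ≤ finrank F A + k * finrank F S := by
  have hle := S.finrank_le
  rcases hle.lt_or_eq with hlt | heq
  · obtain ⟨D, hD⟩ := Submodule.exists_isCompl S
    have hdim : finrank F D + finrank F S = finrank F E := by
      rw [add_comm]
      exact Submodule.finrank_add_eq_of_isCompl hD
    let R : (D →ₗ[F] E) →ₗ[F] A :=
      { toFun := fun f => ⟨f ∘ₗ Submodule.projectionOnto D S hD.symm, hA _ fun x hx => by
          change f (Submodule.projectionOnto D S hD.symm x) = 0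
          rw [(Submodule.projectionOnto_apply_eq_zero_iff hD.symm).2 hx, map_zero]⟩
        map_add' := fun f g => rfl
        map_smul' := fun c f => rfl }
    have hinj : Function.Injective R := by
      intro f g hfg
      refine LinearMap.ext fun x => ?_
      have := congrArg (fun N : A => N.1 x) hfg
      change f (Submodule.projectionOnto D S hD.symm x) =
        g (Submodule.projectionOnto D S hD.symm x) at this
      rwa [Submodule.projectionOnto_apply_left] at this
    have h2 := LinearMap.finrank_le_finrank_of_injective hinj
    rw [Module.finrank_linearMap] at h2
    have h3 : (k + 1) * finrank F D ≤ finrank F D * finrank F E := by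
      rw [mul_comm]
      exact Nat.mul_le_mul_left _ hk
    have h4 : 0 < finrank F D := by omega
    have h5 : k * finrank F E = k * finrank F D + k * finrank F S := by rw [← mul_add, hdim]
    have h6 : (k + 1) * finrank F D = k * finrank F D + finrank F D := by ring
    omega
  · have h2 : 0 < finrank F A := by
      have hnt : Nontrivial E := Module.nontrivial_of_finrank_pos hE
      have : Nontrivial A := ⟨⟨1, h1⟩, 0, fun h => one_ne_zero (congrArg Subtype.val h)⟩
      exact finrank_pos
    rw [heq]
    omega

end StabilizerAlgebra

/-! ### Irredundant sequences and the falling potential -/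

section Chains

open Module

theorem Subgroup.relIndex_ne_zero_of_finite {A : Type*} [Group A] [Finite A] (K H : Subgroup A) :
    K.relIndex H ≠ 0 :=
  Subgroup.index_ne_zero_of_finite

/-- |H : K ⊓ H| = |H : H'| |H' : K ⊓ H'|, and the first factor is at least 2. -/
theorem Subgroup.two_mul_relIndex_le {A : Type*} [Group A] [Finite A] {K H H' : Subgroup A}
    (hlt : H' < H) (h : K ⊓ H = K ⊓ H') : 2 * K.relIndex H' ≤ K.relIndex H := by
  have h1 := Subgroup.relIndex_mul_relIndex (K ⊓ H') H' H inf_le_right hlt.le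
  rw [← h, Subgroup.inf_relIndex_right, h, Subgroup.inf_relIndex_right] at h1
  have h2 : H'.relIndex H ≠ 0 := Subgroup.relIndex_ne_zero_of_finite _ _
  have h3 : H'.relIndex H ≠ 1 := fun h3 => hlt.not_ge (Subgroup.relIndex_eq_one.1 h3)
  rw [← h1, mul_comm]
  exact Nat.mul_le_mul_left _ (by omega)

variable {Ω : Type*}

theorem seqStabilizer_nil (G : Subgroup (Equiv.Perm Ω)) : seqStabilizer G [] = G :=
  le_antisymm (fun _ h => h.1) (fun _ h => ⟨h, by simp⟩)

theorem seqStabilizer_cons (G : Subgroup (Equiv.Perm Ω)) (ω : Ω) (L : List Ω) :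
    seqStabilizer G (ω :: L) = seqStabilizer (seqStabilizer G [ω]) L :=
  le_antisymm
    (fun _ h => ⟨⟨h.1, fun x hx => h.2 x (by simp_all)⟩, fun x hx => h.2 x (by simp [hx])⟩)
    (fun _ h => ⟨h.1.1, fun x hx => by
      rcases List.mem_cons.1 hx with rfl | hx
      · exact h.1.2 x (by simp)
      · exact h.2 x hx⟩)

theorem IsIrredundantSeq.of_cons {G : Subgroup (Equiv.Perm Ω)} {ω : Ω} {L : List Ω}
    (h : IsIrredundantSeq G (ω :: L)) :
    seqStabilizer G [ω] < G ∧ IsIrredundantSeq (seqStabilizer G [ω]) L := by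
  constructor
  · have := h 0 (by simp)
    simpa [seqStabilizer_nil] using this
  · intro i hi
    have := h (i + 1) (by simpa using hi)
    rwa [List.take_succ_cons, List.take_succ_cons, seqStabilizer_cons,
      seqStabilizer_cons G ω (List.take i L)] at this

variable {F E : Type*} [Field F] [AddCommGroup E] [Module F E] [FiniteDimensional F E]

/-- A bound for the length of an irredundant sequence for a permutation group `H` in terms of a
subgroup `K` whose elements act linearly, the points corresponding to `m`-subspaces of `E`. -/
theorem IsIrredundantSeq.two_pow_length_le [Finite Ω] {m : ℕ} (hm : m < finrank F E)
    (W : Ω → Submodule F E) (hW : ∀ ω, finrank F (W ω) = m) (K : Subgroup (Equiv.Perm Ω))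
    (τ : Equiv.Perm Ω → End F E)
    (hτ : ∀ p ∈ K, ∀ ω, p ω = ω ↔ τ p ∈ preserving (W ω)) (L : List Ω) :
    ∀ (H : Subgroup (Equiv.Perm Ω)) (A : Submodule F (End F E)) (S : Submodule F E) (t : ℕ),
      (∀ N : End F E, S ≤ LinearMap.ker N → N ∈ A) → (1 : End F E) ∈ A →
      (∀ p ∈ K ⊓ H, τ p ∈ A) → IsIrredundantSeq H L →
      finrank F A + (finrank F E - m - 1) * finrank F S ≤
        (finrank F E - m - 1) * finrank F E + 1 + t →
      2 ^ L.length ≤ K.relIndex H * 2 ^ t := by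
  induction L with
  | nil =>
    intro H A S t _ _ _ _ _
    rw [List.length_nil, pow_zero]
    exact Nat.mul_pos (Nat.pos_of_ne_zero (Subgroup.relIndex_ne_zero_of_finite _ _)) (by positivity)
  | cons ω L ih =>
    intro H A S t hA h1 hHA hirr ht
    obtain ⟨hlt, hirr'⟩ := hirr.of_cons
    set H' := seqStabilizer H [ω] with hH'
    have hmem : ∀ p, p ∈ H' ↔ p ∈ H ∧ p ω = ω := fun p =>
      ⟨fun h => ⟨h.1, h.2 ω (by simp)⟩, fun h => ⟨h.1, by simpa using h.2⟩⟩
    let A' := A ⊓ preserving (W ω)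
    have hA' : ∀ N : End F E, S ⊔ W ω ≤ LinearMap.ker N → N ∈ A' := fun N hN =>
      ⟨hA N (le_sup_left.trans hN), fun x hx => by
        rw [LinearMap.mem_ker.1 (hN (le_sup_right (a := S) hx))]
        exact Submodule.zero_mem _⟩
    have h1' : (1 : End F E) ∈ A' := ⟨h1, fun x hx => hx⟩
    have hHA' : ∀ p ∈ K ⊓ H', τ p ∈ A' := fun p hp =>
      ⟨hHA p ⟨hp.1, ((hmem p).1 hp.2).1⟩, (hτ p hp.1 ω).1 ((hmem p).1 hp.2).2⟩
    have hstep := finrank_inf_preserving_add_le A S (W ω) hA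
    have hlow := finrank_endomorphisms_lower_bound A' (S ⊔ W ω) hA' h1' (by omega)
      (show finrank F E - m - 1 < finrank F E by omega)
    have hmono : finrank F S ≤ finrank F ↥(S ⊔ W ω) := Submodule.finrank_mono le_sup_left
    rw [hW] at hstep
    obtain ⟨a, ha⟩ := Nat.exists_eq_add_of_le hmono
    obtain ⟨k, hk⟩ : ∃ k, finrank F E = m + k + 1 := ⟨finrank F E - m - 1, by omega⟩
    have e1 : finrank F E - m = k + 1 := by omega
    have e2 : finrank F E - m - 1 = k := by omega
    rw [e2] at ht hlow
    rw [e1, ha, Nat.add_sub_cancel_left] at hstep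
    -- If S grows by a, then A loses at least a (k + 1) dimensions, so dim A + k dim S falls by at
    -- least a.
    have hpot : finrank F A' + k * finrank F ↥(S ⊔ W ω) + a ≤ finrank F A + k * finrank F S := by
      rw [ha]
      calc finrank F A' + k * (finrank F S + a) + a =
          finrank F A' + a * (k + 1) + k * finrank F S := by ring
        _ ≤ _ := Nat.add_le_add_right hstep _
    have hfin : Finite (Equiv.Perm Ω) := inferInstance
    -- If A is unchanged then so is K ⊓ H, and the index halves. Otherwise the potential falls: by
    -- at least a when a > 0, and through dim A alone when a = 0.
    by_cases hAA : A' = A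
    · have hKH : K ⊓ H = K ⊓ H' := by
        ext p
        refine ⟨fun hp => ⟨hp.1, (hmem p).2 ⟨hp.2, (hτ p hp.1 ω).2 ?_⟩⟩,
          fun hp => ⟨hp.1, ((hmem p).1 hp.2).1⟩⟩
        have := hHA p hp
        rw [← hAA] at this
        exact this.2
      have h2 := ih H' A' (S ⊔ W ω) t hA' h1' hHA' hirr' (by rw [e2]; omega)
      calc 2 ^ (ω :: L).length = 2 ^ L.length * 2 := by rw [List.length_cons, pow_succ]
        _ ≤ K.relIndex H' * 2 ^ t * 2 := Nat.mul_le_mul_right 2 h2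
        _ = 2 * K.relIndex H' * 2 ^ t := by ring
        _ ≤ _ := Nat.mul_le_mul_right _ (Subgroup.two_mul_relIndex_le hlt hKH)
    · have hdrop : finrank F A' < finrank F A :=
        Submodule.finrank_lt_finrank_of_lt (lt_of_le_of_ne inf_le_left hAA)
      have hpot' : finrank F A' + k * finrank F ↥(S ⊔ W ω) + 1 ≤
          finrank F A + k * finrank F S := by
        rcases Nat.eq_zero_or_pos a with h0 | h0
        · rw [ha, h0, add_zero]
          omega
        · omega
      -- The floor `hlow` on the new potential shows that t is positive.
      obtain ⟨u, rfl⟩ : ∃ u, t = u + 1 := ⟨t - 1, by omega⟩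
      have h2 := ih H' A' (S ⊔ W ω) u hA' h1' hHA' hirr' (by rw [e2]; omega)
      calc 2 ^ (ω :: L).length = 2 ^ L.length * 2 := by rw [List.length_cons, pow_succ]
        _ ≤ K.relIndex H' * 2 ^ u * 2 := Nat.mul_le_mul_right 2 h2
        _ = K.relIndex H' * 2 ^ (u + 1) := by ring
        _ ≤ _ := Nat.mul_le_mul_right _
          (Subgroup.relIndex_le_of_le_right hlt.le (Subgroup.relIndex_ne_zero_of_finite _ _))

/-- With A everything and S = 0 the potential is d² = (d - m - 1) d + (m + 1) d for d = dim E, which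
leaves t = (m + 1) d - 1. -/
theorem IsIrredundantSeq.two_pow_length_succ_le [Finite Ω] {m : ℕ} (hm : m < finrank F E)
    (W : Ω → Submodule F E) (hW : ∀ ω, finrank F (W ω) = m) (K : Subgroup (Equiv.Perm Ω))
    (hK : ∀ p ∈ K, ∃ N : End F E, ∀ ω, p ω = ω ↔ N ∈ preserving (W ω)) {L : List Ω}
    {H : Subgroup (Equiv.Perm Ω)} (hL : IsIrredundantSeq H L) :
    2 ^ (L.length + 1) ≤ K.relIndex H * 2 ^ ((m + 1) * finrank F E) := by
  choose! τ hτ using hK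
  obtain ⟨t, ht⟩ : ∃ t, (m + 1) * finrank F E = t + 1 := by
    refine ⟨(m + 1) * finrank F E - 1, ?_⟩
    have : 0 < (m + 1) * finrank F E := by
      have : 0 < finrank F E := by omega
      positivity
    omega
  have h := IsIrredundantSeq.two_pow_length_le hm W hW K τ hτ L H ⊤ ⊥ t (fun _ _ => trivial) trivial
    (fun _ _ => trivial) hL (by
      rw [finrank_bot, finrank_top, Module.finrank_linearMap, add_assoc, add_comm 1 t, ← ht]
      obtain ⟨k, hk⟩ : ∃ k, finrank F E = m + k + 1 := ⟨finrank F E - m - 1, by omega⟩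
      have e2 : finrank F E - m - 1 = k := by omega
      rw [e2, hk]
      apply le_of_eq
      ring)
  rw [ht, pow_succ, pow_succ, ← mul_assoc]
  exact Nat.mul_le_mul_right 2 h

end Chains

/-! ### Counting subspaces and field automorphisms -/

section Counting

open Module

variable {F V : Type*} [Field F] [AddCommGroup V] [Module F V] [FiniteDimensional F V]

/-- Graphs of maps W → Q are distinct m-subspaces complementary to Q; an m-subspace meeting Q gives
one more. -/
theorem pow_lt_card_subspacesOfDim [Finite F] {m : ℕ} (h0 : 0 < m) (h1 : m < finrank F V) :
    Nat.card F ^ (m * (finrank F V - m)) < Nat.card (SubspacesOfDim F V m) := by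
  have : Finite V := Module.finite_of_finite F
  have : Finite (SubspacesOfDim F V m) := Subtype.finite
  obtain ⟨W, -, -, hW⟩ := exists_le_le_finrank_eq (bot_le : (⊥ : Submodule F V) ≤ ⊤) (m := m)
    (by simp) (by rw [finrank_top]; exact h1.le)
  obtain ⟨Q, hQ⟩ := Submodule.exists_isCompl W
  have hdim := Submodule.finrank_add_eq_of_isCompl hQ
  let gr : (W →ₗ[F] Q) → (W →ₗ[F] V) := fun f => W.subtype + Q.subtype ∘ₗ f
  have hgr : ∀ f x, gr f x = (x : V) + f x := fun f x => rfl
  have hsplit : ∀ {x y : W} {a b : Q}, (x : V) + a = y + b → x = y ∧ a = b := by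
    intro x y a b h
    have h2 : ((x - y : W) : V) = ((b - a : Q) : V) := by
      rw [Submodule.coe_sub, Submodule.coe_sub, sub_eq_sub_iff_add_eq_add, h, add_comm]
    have h3 := Submodule.disjoint_def.1 hQ.disjoint _ (x - y).2 (h2 ▸ (b - a).2)
    have h4 : b - a = 0 := Subtype.ext (h2 ▸ h3)
    exact ⟨sub_eq_zero.1 (Subtype.ext h3), (sub_eq_zero.1 h4).symm⟩
  have hinj : ∀ f, Function.Injective (gr f) := fun f x y hxy => (hsplit hxy).1
  obtain ⟨v, hvQ, hv⟩ : ∃ v ∈ Q, v ≠ 0 := by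
    refine Submodule.exists_mem_ne_zero_of_ne_bot fun hbot => ?_
    rw [hbot, finrank_bot] at hdim
    omega
  obtain ⟨U, hvU, -, hU⟩ := exists_le_le_finrank_eq (le_top : Submodule.span F {v} ≤ ⊤) (m := m)
    (by rw [finrank_span_singleton hv]; exact h0) (by rw [finrank_top]; exact h1.le)
  have hvU : v ∈ U := hvU (Submodule.mem_span_singleton_self v)
  let Φ : Option (W →ₗ[F] Q) → SubspacesOfDim F V m := fun o =>
    o.elim ⟨U, hU⟩ fun f => ⟨LinearMap.range (gr f), by
      rw [LinearMap.finrank_range_of_inj (hinj f), hW]⟩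
  have hne : ∀ f, LinearMap.range (gr f) ≠ U := by
    intro f h
    rw [← h] at hvU
    obtain ⟨x, hx⟩ := hvU
    have h2 := hsplit (x := x) (y := 0) (a := f x) (b := ⟨v, hvQ⟩) (by
      rw [← hgr, hx, Submodule.coe_zero, zero_add])
    have h3 := h2.2
    rw [h2.1, map_zero] at h3
    exact hv (congrArg Subtype.val h3).symm
  have hΦ : Function.Injective Φ := by
    rintro (_ | f) (_ | g) h
    · rfl
    · exact absurd (congrArg Subtype.val h).symm (hne g)
    · exact absurd (congrArg Subtype.val h) (hne f)
    · have h2 : LinearMap.range (gr f) = LinearMap.range (gr g) := congrArg Subtype.val h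
      congr 1
      refine LinearMap.ext fun x => ?_
      have h3 : gr f x ∈ LinearMap.range (gr g) := h2 ▸ ⟨x, rfl⟩
      obtain ⟨y, hy⟩ := h3
      have h4 := hsplit hy
      rw [← h4.2, h4.1]
  have : Finite (W →ₗ[F] Q) := Module.finite_of_finite F
  have hcard := Nat.card_le_card_of_injective Φ hΦ
  rw [Finite.card_option, Module.natCard_eq_pow_finrank (K := F), Module.finrank_linearMap, hW]
    at hcard
  rwa [show finrank F V - m = finrank F Q by omega]

/-- Endomorphisms of F are linear over the prime field, so there are at most as many as the degree
of F over it. -/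
theorem two_pow_card_ringHom_le (F : Type*) [Field F] [Finite F] :
    2 ^ Nat.card (F →+* F) ≤ Nat.card F := by
  obtain ⟨p, hchar⟩ := CharP.exists F
  have hp : Fact p.Prime := ⟨CharP.char_is_prime F p⟩
  let _ : Algebra (ZMod p) F := ZMod.algebra F p
  have : FiniteDimensional (ZMod p) F := Module.Finite.of_finite
  have hfix : ∀ (σ : F →+* F) (r : ZMod p), σ (algebraMap (ZMod p) F r) = algebraMap (ZMod p) F r :=
    fun σ r => RingHom.congr_fun
      (RingHom.ext_zmod (σ.comp (algebraMap (ZMod p) F)) (algebraMap (ZMod p) F)) r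
  let T : (F →+* F) → (F →ₐ[ZMod p] F) := fun σ => { σ with commutes' := hfix σ }
  have hT : Function.Injective T := fun σ τ h => RingHom.ext fun x =>
    congrArg (fun f : F →ₐ[ZMod p] F => f x) h
  have : Finite (F →ₐ[ZMod p] F) := inferInstance
  have h1 : Nat.card (F →+* F) ≤ finrank (ZMod p) F :=
    (Nat.card_le_card_of_injective T hT).trans (card_algHom_le_finrank (ZMod p) F F)
  rw [Module.natCard_eq_pow_finrank (K := ZMod p) (V := F), Nat.card_zmod]
  exact (Nat.pow_le_pow_left hp.out.two_le _).trans
    (Nat.pow_le_pow_right hp.out.pos h1)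

/-- With M = m (d - m), 2m ≤ d gives (m + 1) d ≤ 3M + 1. For q ≥ 3 the excess is absorbed by q³; for
q = 2 one has r ≤ 1 and the excess occurs only for m = 1, d = 2, where 16 < 27. -/
theorem mul_two_pow_lt_cube {m d q r : ℕ} (h0 : 0 < m) (hmd : 2 * m ≤ d) (hq : 2 ≤ q)
    (hr : 2 ^ r ≤ q) : r * 2 ^ ((m + 1) * d) < (q ^ (m * (d - m)) + 1) ^ 3 := by
  obtain ⟨k, rfl⟩ := Nat.exists_eq_add_of_le hmd
  obtain ⟨a, rfl⟩ : ∃ a, m = a + 1 := ⟨m - 1, by omega⟩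
  have e1 : 2 * (a + 1) + k - (a + 1) = a + 1 + k := by omega
  rw [e1]
  set M := (a + 1) * (a + 1 + k) with hM
  have hM0 : 0 < M := by positivity
  have hexp : (a + 1 + 1) * (2 * (a + 1) + k) ≤ 3 * M + 1 := by
    rw [hM]
    nlinarith [Nat.zero_le (a * a), Nat.zero_le (a * k)]
  have hcube : (q ^ M) ^ 3 < (q ^ M + 1) ^ 3 := Nat.pow_lt_pow_left (Nat.lt_succ_self _) (by simp)
  rcases hq.lt_or_eq with hq3 | hq2
  · refine lt_of_le_of_lt ?_ hcube
    -- Since 2^(3M+1) = 16 (2^(M-1))³, one factor q³ has to absorb 16 r.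
    have hrq : 16 * r ≤ q ^ 3 := by
      rcases Nat.lt_or_ge r 2 with h | h
      · calc 16 * r ≤ 16 * 1 := by omega
          _ ≤ 3 ^ 3 := by norm_num
          _ ≤ q ^ 3 := Nat.pow_le_pow_left hq3 3
      · obtain ⟨s, rfl⟩ := Nat.exists_eq_add_of_le h
        have hs : 2 + s ≤ 4 * 8 ^ s := by
          have : s < 8 ^ s := Nat.lt_pow_self (by norm_num)
          omega
        calc 16 * (2 + s) ≤ 16 * (4 * 8 ^ s) := Nat.mul_le_mul_left _ hs
          _ = (2 ^ (2 + s)) ^ 3 := by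
            rw [← pow_mul, mul_comm (2 + s) 3, pow_mul, pow_add]
            norm_num
            ring
          _ ≤ q ^ 3 := Nat.pow_le_pow_left hr 3
    obtain ⟨N, hN⟩ : ∃ N, M = N + 1 := ⟨M - 1, by omega⟩
    calc r * 2 ^ ((a + 1 + 1) * (2 * (a + 1) + k)) ≤ r * 2 ^ (3 * M + 1) :=
          Nat.mul_le_mul_left _ (Nat.pow_le_pow_right (by norm_num) hexp)
      _ = 16 * r * (2 ^ N) ^ 3 := by
        rw [hN]
        ring
      _ ≤ q ^ 3 * (q ^ N) ^ 3 :=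
        Nat.mul_le_mul hrq (Nat.pow_le_pow_left (Nat.pow_le_pow_left hq N) 3)
      _ = (q ^ M) ^ 3 := by
        rw [hN]
        ring
  · subst hq2
    have hr1 : r ≤ 1 := by
      by_contra! h
      have := Nat.pow_le_pow_right (n := 2) (by norm_num) (show 2 ≤ r from h)
      omega
    by_cases hexp' : (a + 1 + 1) * (2 * (a + 1) + k) ≤ 3 * M
    · refine lt_of_le_of_lt ?_ hcube
      rw [← pow_mul, mul_comm M 3]
      calc r * 2 ^ ((a + 1 + 1) * (2 * (a + 1) + k)) ≤ 1 * 2 ^ (3 * M) :=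
            Nat.mul_le_mul hr1 (Nat.pow_le_pow_right (by norm_num) hexp')
        _ = _ := one_mul _
    · have h2 : a = 0 ∧ k = 0 := by
        rw [hM] at hexp'
        constructor
        · by_contra h
          have : 0 < a := by omega
          apply hexp'
          nlinarith [Nat.zero_le (a * k)]
        · by_contra h
          have : 0 < k := by omega
          apply hexp'
          nlinarith [Nat.zero_le (a * k)]
      obtain ⟨rfl, rfl⟩ := h2
      rw [hM]
      calc _ ≤ 1 * 2 ^ ((0 + 1 + 1) * (2 * (0 + 1) + 0)) := Nat.mul_le_mul_right _ hr1
        _ < _ := by norm_num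

end Counting

/-! ### The main theorem -/

section Main

open Module

instance groupSocle_normal (G : Type*) [Group G] : (groupSocle G).Normal :=
  Subgroup.sSup_normal _ fun N hN => (show IsMinimalNormal N from hN).prop.1

variable {F V : Type*} [Field F] [AddCommGroup V] [Module F V] [FiniteDimensional F V] {m : ℕ}

theorem range_pslToPermSubspaces : (pslToPermSubspaces F V m).range = slImage F V m := by
  ext p
  constructor
  · rintro ⟨x, rfl⟩
    obtain ⟨s, rfl⟩ := QuotientGroup.mk_surjective x
    exact ⟨s, rfl⟩
  · rintro ⟨s, rfl⟩
    exact ⟨QuotientGroup.mk s, rfl⟩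

theorem le_normalizer_slImage {G : Subgroup (Equiv.Perm (SubspacesOfDim F V m))}
    (hsoc : (groupSocle G).map G.subtype = (pslToPermSubspaces F V m).range) :
    G ≤ Subgroup.normalizer (slImage F V m : Set (Equiv.Perm (SubspacesOfDim F V m))) := by
  rw [range_pslToPermSubspaces] at hsoc
  have key : ∀ g ∈ G, ∀ p ∈ slImage F V m, g * p * g⁻¹ ∈ slImage F V m := by
    intro g hg p hp
    rw [← hsoc] at hp ⊢
    obtain ⟨x, hx, rfl⟩ := hp
    exact ⟨⟨g, hg⟩ * x * ⟨g, hg⟩⁻¹, (groupSocle_normal G).conj_mem x hx _, rfl⟩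
  intro g hg
  refine Subgroup.mem_normalizer_iff.2 fun p => ⟨key g hg p, fun h => ?_⟩
  have := key g⁻¹ (inv_mem hg) _ h
  rwa [inv_inv, mul_assoc, mul_assoc, inv_mul_cancel, mul_one, inv_mul_cancel_left] at this

theorem IsAlmostSimple.nontrivial {G : Type*} [Group G] (hG : IsAlmostSimple G) : Nontrivial G := by
  obtain ⟨S, _, -, ⟨a, b, hab⟩, A, hA, ⟨f⟩⟩ := hG
  by_contra hcon
  rw [not_nontrivial_iff_subsingleton] at hcon
  have : Subsingleton A := f.symm.toEquiv.subsingleton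
  have h1 : (⟨MulAut.conj a, hA ⟨a, rfl⟩⟩ : A) = 1 := Subsingleton.elim _ _
  have h2 : MulAut.conj a b = b := by
    rw [show MulAut.conj a = 1 from congrArg Subtype.val h1]
    rfl
  rw [MulAut.conj_apply, mul_inv_eq_iff_eq_mul] at h2
  exact hab h2

theorem pos_and_lt_of_nontrivial (h : Nontrivial (SubspacesOfDim F V m)) :
    0 < m ∧ m < finrank F V := by
  obtain ⟨U, W, hUW⟩ := h
  constructor
  · rw [Nat.pos_iff_ne_zero]
    rintro rfl
    exact hUW (Subtype.ext ((Submodule.finrank_eq_zero.1 U.2).trans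
      (Submodule.finrank_eq_zero.1 W.2).symm))
  · by_contra! hcon
    have hU := U.1.finrank_le
    have hW := W.1.finrank_le
    rw [U.2] at hU
    rw [W.2] at hW
    have h1 : U.1 = ⊤ := Submodule.eq_top_of_finrank_eq (U.2.trans (by omega))
    have h2 : W.1 = ⊤ := Submodule.eq_top_of_finrank_eq (W.2.trans (by omega))
    exact hUW (Subtype.ext (h1.trans h2.symm))

/-- Stabilisers of subspaces in the general linear group are stabilisers of their annihilators. -/
theorem permHom_apply_eq_iff_dualMap (g : V ≃ₗ[F] V) (W : SubspacesOfDim F V m) :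
    permHom m g W = W ↔ (g : V →ₗ[F] V).dualMap ∈ preserving W.1.dualAnnihilator := by
  rw [permHom_apply_eq_iff, mem_preserving]
  constructor
  · intro h φ hφ
    rw [Submodule.mem_dualAnnihilator] at hφ ⊢
    exact fun x hx => hφ _ (h x hx)
  · intro h x hx
    rw [← Subspace.forall_mem_dualAnnihilator_apply_eq_zero_iff]
    intro φ hφ
    exact (Submodule.mem_dualAnnihilator _).1 (h φ hφ) x hx

theorem two_pow_length_lt_card_cube [Finite F] (h0 : 0 < m) (h1 : m < finrank F V)
    {G : Subgroup (Equiv.Perm (SubspacesOfDim F V m))}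
    (hG : G ≤ Subgroup.normalizer (slImage F V m : Set (Equiv.Perm (SubspacesOfDim F V m))))
    {L : List (SubspacesOfDim F V m)} (hL : IsIrredundantSeq G L) :
    2 ^ L.length < Nat.card (SubspacesOfDim F V m) ^ 3 := by
  have : Finite V := Module.finite_of_finite F
  have : Finite (SubspacesOfDim F V m) := Subtype.finite
  have hn := pow_lt_card_subspacesOfDim (F := F) (V := V) h0 h1
  have hcube := Nat.pow_le_pow_left (Nat.add_one_le_iff.2 hn) 3
  have hq : 2 ≤ Nat.card F := Finite.one_lt_card
  have hr := two_pow_card_ringHom_le F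
  have hindex : (permHom (F := F) (V := V) m).range.relIndex G ≤ 2 * Nat.card (F →+* F) :=
    (Subgroup.relIndex_le_of_le_right hG (Subgroup.relIndex_ne_zero_of_finite _ _)).trans
      (relIndex_range_permHom_normalizer_le h0 h1)
  -- The 2 in the index bound, due to dualities, cancels against the extra 2 on the left.
  have hhalf : ∀ t, 2 ^ (L.length + 1) ≤ (permHom (F := F) (V := V) m).range.relIndex G * 2 ^ t →
      2 ^ L.length ≤ Nat.card (F →+* F) * 2 ^ t := by
    intro t ht
    have h2 := ht.trans (Nat.mul_le_mul_right _ hindex)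
    rw [pow_succ, mul_comm, mul_assoc] at h2
    exact Nat.le_of_mul_le_mul_left h2 (by norm_num)
  rcases Nat.le_total (2 * m) (finrank F V) with hle | hle
  · have h2 := hhalf _ (hL.two_pow_length_succ_le h1 (fun ω => ω.1) (fun ω => ω.2) _ (by
      rintro _ ⟨g, rfl⟩
      exact ⟨g, fun ω => permHom_apply_eq_iff g ω⟩))
    exact (h2.trans_lt (mul_two_pow_lt_cube h0 hle hq hr)).trans_le hcube
  -- The chain bound is not symmetric under m ↦ d - m; passing to annihilators makes the exponent (d
  -- - m + 1) d.
  · have hdual : ∀ ω : SubspacesOfDim F V m,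
        finrank F ω.1.dualAnnihilator = finrank F V - m := by
      intro ω
      have := Subspace.finrank_add_finrank_dualAnnihilator_eq ω.1
      rw [ω.2] at this
      omega
    have hlt : finrank F V - m < finrank F (Dual F V) := by
      rw [Subspace.dual_finrank_eq]
      omega
    have hstab : ∀ p ∈ (permHom (F := F) (V := V) m).range, ∃ f : Dual F V →ₗ[F] Dual F V,
        ∀ ω : SubspacesOfDim F V m, p ω = ω ↔ f ∈ preserving ω.1.dualAnnihilator := by
      rintro _ ⟨g, rfl⟩
      exact ⟨_, fun ω => permHom_apply_eq_iff_dualMap g ω⟩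
    have hmain := hL.two_pow_length_succ_le (E := Dual F V) (m := finrank F V - m) hlt
      (fun ω => ω.1.dualAnnihilator)
    have h2 := hhalf _ (hmain hdual _ hstab)
    rw [Subspace.dual_finrank_eq] at h2
    have h3 := mul_two_pow_lt_cube (m := finrank F V - m) (d := finrank F V) (by omega)
      (by omega) hq hr
    rw [show finrank F V - (finrank F V - m) = m by omega, mul_comm (finrank F V - m) m] at h3
    exact (h2.trans_lt h3).trans_le hcube

end Main

theorem mainTheorem8 {F V : Type*} [Field F] [Finite F] [AddCommGroup V] [Module F V]
    [FiniteDimensional F V] (m : ℕ)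
    (G : Subgroup (Equiv.Perm (SubspacesOfDim F V m)))
    (hG : IsAlmostSimple G)
    (hsoc : (groupSocle G).map G.subtype = (pslToPermSubspaces F V m).range) :
    (maxIrredundantBaseSize G : ℝ) < 3 * Real.logb 2 (Nat.card (SubspacesOfDim F V m)) := by
  have hV : Finite V := Module.finite_of_finite F
  have hΩ : Finite (SubspacesOfDim F V m) := Subtype.finite
  -- If Ω had at most one point, G would be trivial, hence not almost simple.
  have hnt : Nontrivial (SubspacesOfDim F V m) := by
    by_contra hcon
    rw [not_nontrivial_iff_subsingleton] at hcon
    exact not_subsingleton_iff_nontrivial.2 hG.nontrivial inferInstance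
  obtain ⟨h0, h1⟩ := pos_and_lt_of_nontrivial hnt
  obtain ⟨L, hL, hlen⟩ := (isGreatest_maxIrredundantBaseSize G).1
  have hlt := two_pow_length_lt_card_cube h0 h1 (le_normalizer_slImage hsoc) hL.1
  rw [hlen] at hlt
  have hpos : (0 : ℝ) < Nat.card (SubspacesOfDim F V m) := by exact_mod_cast Nat.card_pos
  have h3 : (3 : ℝ) * Real.logb 2 (Nat.card (SubspacesOfDim F V m)) =
      Real.logb 2 ((Nat.card (SubspacesOfDim F V m) : ℝ) ^ 3) := by
    rw [Real.logb_pow]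
    norm_num
  rw [h3, Real.lt_logb_iff_rpow_lt (by norm_num) (by positivity), Real.rpow_natCast]
  exact_mod_cast hlt
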